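/- **Setting.** Let $\mathbb K=\mathbb R$ or $\mathbb C$. Let $\mathbb A_n^k$ be the space of $k$-tuples of germs at $0\in\mathbb K^n$ of analytic functions, identified with their (convergent) Taylor series. For $F\in\mathbb A_n^k$ let $F^{(i)}$ be its homogeneous part of degree $i$, let $\|F^{(i)}\|=\max_{1\le j\le k}\sum_{|\alpha|=i}|F_{j,\alpha}|$, where $F_{j,\alpha}$ are the Taylor coefficients, and let $\widehat F(z)=\sum_{i\ge 0}\|F^{(i)}\|z^i$. For (Laurent) series in one variable $z$, $\sum f_kz^k\prec\sum g_kz^k$ means $g_k\ge 0$ and $|f_k|\le g_k$ for all $k$. Let ${\bf m}=(m_1,\dots,m_r)\in\mathbb N^r$, let $q\ge 0$ be an integer and let $d\ge-\min_i m_i$ be an integer. Let $$\mathcal F^{>d}_{r,{\bf m}}=\{F=(F_1,\dots,F_r)\in\mathbb A_n^r:\ F_j\text{ has zero }(m_j+d)\text{-jet at }0,\ 1\le j\le r\}.$$ For tuples in $\mathcal F^{>d}_{r,{\bf m}}$ the order is taken with respect to ${\bf m}$: $\operatorname{ord}_0F=\min_j(\operatorname{ord}_0F_j-m_j)$; for tuples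 in $\mathbb A_n^s$ it is the usual order $\operatorname{ord}_0 G=\min_i\operatorname{ord}_0G_i$. A map $\mathcal T:\mathcal F^{>d}_{r,{\bf m}}\to\mathbb A_n^s$ increases the order by $e\in\mathbb Z$ if $\operatorname{ord}_0(\mathcal T(F)-\mathcal T(G))\ge\operatorname{ord}_0(F-G)+e$ for all $F,G$, and strictly increases it by $e$ if this holds with $>$ for all $F\ne G$. Write $\partial F=\left(\partial^{|\alpha|}F_j/\partial x^\alpha\right)_{1\le j\le r,\ |\alpha|\le m_j}$ and let $u_{j,\alpha}$ be the corresponding coordinates on the jet space. **Theorem.** Suppose that: 1. $\mathcal T:\mathcal F^{>d}_{r,{\bf m}}\to\mathbb A_n^s$ is a differential analytic map of order ${\bf m}$, that is, there is a $\mathbb K^s$-valued function $W(x,u)$, analytic near each point $(0,\partial F(0))$ with $F\in\mathcal F^{>d}_{r,{\bf m}}$ (if $d\ge 0$, this is only the point $(0,0)$), such that $\mathcal T(F)(x)=W(x,\partial F(x))$ for $x$ near $0$, for every $F\in\mathcal F^{>d}_{r,{\bf m}}$. Moreover $\mathcal T$ strictly increases the order by $q-d$, and $j_0^q\mathcal T(0)=0$.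 2. $\mathcal T$ is $d$-regular: for every $F\in\mathcal F^{>d}_{r,{\bf m}}$ (equivalently, for every such formal $F$) and all $1\le i\le s$, $1\le j\le r$, $|\alpha|\le m_j$, $$\operatorname{ord}_0\left(\frac{\partial W_i}{\partial u_{j,\alpha}}(x,\partial F(x))\right)\ge\max(0,|\alpha|+q+1-m_j-d).$$ 3. $\mathcal S:\mathcal F^{>d}_{r,{\bf m}}\to\mathbb A_n^s$ is linear and increases the order by $q-d$. 4. $\pi:\mathbb A_n^s\to\operatorname{Im}\mathcal S$ is a linear projection onto $\operatorname{Im}\mathcal S$. 5. There are a linear right inverse $\mathcal S^{-1}:\operatorname{Im}\mathcal S\to\mathcal F^{>d}_{r,{\bf m}}$ of $\mathcal S$, i.e. $\mathcal S\circ\mathcal S^{-1}=\mathrm{id}_{\operatorname{Im}\mathcal S}$ (for instance the inverse of $\mathcal S$ on its image, if $\mathcal S$ is injective), and a constant $C>0$ such that for every $G\in\mathbb A_n^s$ of order $\ge q+1$ and all $1\le i\le r$, $$\frac{d^{m_i}}{dz^{m_i}}\left(z^{q-d}\,\widehat{\mathcal S_i^{-1}(\pi(G))}\right)\prec C\,\widehat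 G,$$ where $\mathcal S_i^{-1}$ is the $i$-th component of $\mathcal S^{-1}$. Then the equation $\mathcal S(F)=\pi(\mathcal T(F))$ has an analytic solution $F\in\mathcal F^{>d}_{r,{\bf m}}$. -/

import Mathlib

open Filter Topology

namespace BigDenominators

noncomputable section

/-! Germs of analytic functions at the origin are represented by their Taylor series: a germ is the
same thing as a formal power series that converges absolutely on some polydisc around the origin. -/

/-- Absolute convergence on a polydisc of some positive radius `ρ`, that is
`∑ i, ‖f ^ (i)‖ * ρ ^ i < ∞`. -/
def IsConvergent {𝕜 : Type*} [RCLike 𝕜] {n : ℕ} (f : MvPowerSeries (Fin n) 𝕜) : Prop :=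
  ∃ ρ : ℝ, 0 < ρ ∧ Summable fun α : Fin n →₀ ℕ => ‖MvPowerSeries.coeff α f‖ * ρ ^ α.degree

theorem IsConvergent.zero {𝕜 : Type*} [RCLike 𝕜] {n : ℕ} :
    IsConvergent (0 : MvPowerSeries (Fin n) 𝕜) :=
  ⟨1, one_pos, by simp [summable_zero]⟩

theorem IsConvergent.add {𝕜 : Type*} [RCLike 𝕜] {n : ℕ} {f g : MvPowerSeries (Fin n) 𝕜}
    (hf : IsConvergent f) (hg : IsConvergent g) : IsConvergent (f + g) := by
  obtain ⟨a, ha, hfa⟩ := hf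
  obtain ⟨b, hb, hgb⟩ := hg
  have hm : 0 < min a b := lt_min ha hb
  refine ⟨min a b, hm, Summable.of_nonneg_of_le (fun α => by positivity) (fun α => ?_)
    (hfa.add hgb)⟩
  have h1 : (min a b) ^ α.degree ≤ a ^ α.degree :=
    pow_le_pow_left₀ hm.le (min_le_left a b) _
  have h2 : (min a b) ^ α.degree ≤ b ^ α.degree :=
    pow_le_pow_left₀ hm.le (min_le_right a b) _
  calc ‖MvPowerSeries.coeff α (f + g)‖ * (min a b) ^ α.degree
      ≤ (‖MvPowerSeries.coeff α f‖ + ‖MvPowerSeries.coeff α g‖) * (min a b) ^ α.degree := by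
        rw [map_add]
        gcongr
        exact norm_add_le _ _
    _ ≤ _ := by
        rw [add_mul]
        gcongr

theorem IsConvergent.smul {𝕜 : Type*} [RCLike 𝕜] {n : ℕ} {f : MvPowerSeries (Fin n) 𝕜} (c : 𝕜)
    (hf : IsConvergent f) : IsConvergent (c • f) := by
  obtain ⟨a, ha, hfa⟩ := hf
  refine ⟨a, ha, (hfa.mul_left ‖c‖).congr fun α => ?_⟩
  simp [mul_assoc]

/-- The space `𝔸ₙᵏ` of `k`-tuples of germs at the origin of analytic functions of `n` variables. -/
def An (𝕜 : Type*) [RCLike 𝕜] (n k : ℕ) : Submodule 𝕜 (Fin k → MvPowerSeries (Fin n) 𝕜) where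
  carrier := {F | ∀ j, IsConvergent (F j)}
  zero_mem' := fun _ => IsConvergent.zero
  add_mem' := fun hF hG j => (hF j).add (hG j)
  smul_mem' := fun c _ hF j => (hF j).smul c

/-- The space `𝓕^{>i}_{r,m}` of `r`-tuples of analytic germs whose `j`-th component has zero
`(m j + i)`-jet at the origin. -/
def Filt (𝕜 : Type*) [RCLike 𝕜] (n : ℕ) {r : ℕ} (m : Fin r → ℕ) (i : ℤ) :
    Submodule 𝕜 (Fin r → MvPowerSeries (Fin n) 𝕜) where
  carrier := {F | F ∈ An 𝕜 n r ∧
    ∀ j (α : Fin n →₀ ℕ), (α.degree : ℤ) ≤ m j + i → MvPowerSeries.coeff α (F j) = 0}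
  zero_mem' := ⟨Submodule.zero_mem _, fun _ _ _ => by simp⟩
  add_mem' := fun hF hG => ⟨Submodule.add_mem _ hF.1 hG.1, fun j α h => by
    simp [hF.2 j α h, hG.2 j α h]⟩
  smul_mem' := fun c _ hF => ⟨Submodule.smul_mem _ c hF.1, fun j α h => by
    simp [hF.2 j α h]⟩

/-- The order at the origin of a tuple with respect to the filtration `𝓕_{r,m}`: the largest `i`
such that every component `F j` has order at least `m j + i`, and `⊤` for `F = 0`. For `m = 0` it is
the usual order of a tuple of power series. -/
def ord {𝕜 : Type*} [RCLike 𝕜] {n r : ℕ} (m : Fin r → ℕ) (F : Fin r → MvPowerSeries (Fin n) 𝕜) :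
    WithTop ℤ :=
  Finset.univ.inf fun j => WithTop.map (fun k : ℕ => (k : ℤ) - m j) (F j).order

/-- `T : 𝓕^{>d}_{r,m} → 𝔸ₙˢ` increases the order at the origin by the integer `e`. -/
def IncreasesOrder {𝕜 : Type*} [RCLike 𝕜] {n r s : ℕ} {m : Fin r → ℕ} {d : ℤ}
    (T : Filt 𝕜 n m d → An 𝕜 n s) (e : ℤ) : Prop :=
  ∀ F G : Filt 𝕜 n m d,
    ord m (F.1 - G.1) + (e : WithTop ℤ) ≤ ord (fun _ => 0) ((T F).1 - (T G).1)

/-- `T : 𝓕^{>d}_{r,m} → 𝔸ₙˢ` strictly increases the order at the origin by the integer `e`. -/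
def StrictlyIncreasesOrder {𝕜 : Type*} [RCLike 𝕜] {n r s : ℕ} {m : Fin r → ℕ} {d : ℤ}
    (T : Filt 𝕜 n m d → An 𝕜 n s) (e : ℤ) : Prop :=
  ∀ F G : Filt 𝕜 n m d, F ≠ G →
    ord m (F.1 - G.1) + (e : WithTop ℤ) < ord (fun _ => 0) ((T F).1 - (T G).1)

/-- The sum of a power series at the point `x`. -/
def eval {𝕜 : Type*} [RCLike 𝕜] {n : ℕ} (f : MvPowerSeries (Fin n) 𝕜) (x : Fin n → 𝕜) : 𝕜 :=
  ∑' α : Fin n →₀ ℕ, MvPowerSeries.coeff α f * ∏ i, x i ^ α i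

/-- The partial derivative `∂^{|α|} f / ∂x^α`, computed coefficientwise. -/
def partialDeriv {𝕜 : Type*} [RCLike 𝕜] {n : ℕ} (α : Fin n →₀ ℕ) (f : MvPowerSeries (Fin n) 𝕜) :
    MvPowerSeries (Fin n) 𝕜 :=
  fun β => (∏ i, (((β i + α i).descFactorial (α i) : ℕ) : 𝕜)) * MvPowerSeries.coeff (β + α) f

/-- The indices `(j, α)`, `|α| ≤ m j`, of the coordinates `u_{j,α}` on the jet space. -/
abbrev JetIndex (n : ℕ) {r : ℕ} (m : Fin r → ℕ) : Type :=
  Σ j : Fin r, {α : Fin n →₀ ℕ // α.degree ≤ m j}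

instance instFintypeJetIndex (n : ℕ) {r : ℕ} (m : Fin r → ℕ) : Fintype (JetIndex n m) :=
  haveI : ∀ j : Fin r, Finite {α : Fin n →₀ ℕ // α.degree ≤ m j} := fun j =>
    (Finsupp.finite_of_degree_le (σ := Fin n) (m j)).to_subtype
  Fintype.ofFinite _

/-- The value at `x` of the jet `(∂^{|α|} F_j / ∂x^α)_{|α| ≤ m j}` of a tuple `F`. -/
def jet {𝕜 : Type*} [RCLike 𝕜] {n r : ℕ} (m : Fin r → ℕ) (F : Fin r → MvPowerSeries (Fin n) 𝕜)
    (x : Fin n → 𝕜) : JetIndex n m → 𝕜 :=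
  fun p => eval (partialDeriv p.2.1 (F p.1)) x

/-- `f` is the Taylor series at the origin of the function `g`, which is analytic there. -/
def IsTaylorSeries {𝕜 : Type*} [RCLike 𝕜] {n : ℕ} (f : MvPowerSeries (Fin n) 𝕜)
    (g : (Fin n → 𝕜) → 𝕜) : Prop :=
  IsConvergent f ∧ ∀ᶠ x in 𝓝 (0 : Fin n → 𝕜), g x = eval f x

/-- `T` is a differential analytic map of order `m`, defined by the function `W` on the jet space:
`W` is analytic near every point `(0, j_0 F)`, and `T F` is the germ of `x ↦ W (x, j_x F)`, for all
`F ∈ 𝓕^{>d}_{r,m}`. For `d ≥ 0` the only such point is the origin. -/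
def IsDifferentialAnalytic {𝕜 : Type*} [RCLike 𝕜] {n r s : ℕ} {m : Fin r → ℕ} {d : ℤ}
    (W : (Fin n → 𝕜) × (JetIndex n m → 𝕜) → Fin s → 𝕜) (T : Filt 𝕜 n m d → An 𝕜 n s) : Prop :=
  ∀ F : Filt 𝕜 n m d, AnalyticAt 𝕜 W (0, jet m F.1 0) ∧
    ∀ i, IsTaylorSeries ((T F).1 i) fun x => W (x, jet m F.1 x) i

/-- The partial derivative `∂W_i / ∂u_{j,α}` at a point of the jet space. -/
def jetPartial {𝕜 : Type*} [RCLike 𝕜] {n r s : ℕ} {m : Fin r → ℕ}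
    (W : (Fin n → 𝕜) × (JetIndex n m → 𝕜) → Fin s → 𝕜) (i : Fin s) (p : JetIndex n m)
    (v : (Fin n → 𝕜) × (JetIndex n m → 𝕜)) : 𝕜 :=
  fderiv 𝕜 W v (0, Pi.single p 1) i

/-- `d`-regularity: the germ `x ↦ (∂W_i / ∂u_{j,α}) (x, ∂F)` has order at least
`max (0, |α| + q + 1 - m j - d)` for every `F ∈ 𝓕^{>d}_{r,m}`. This order condition concerns only a
finite jet of `F`, so requiring it of convergent or of formal `F` is the same. -/
def IsJetRegular {𝕜 : Type*} [RCLike 𝕜] {n r s : ℕ} {m : Fin r → ℕ} (q : ℕ) (d : ℤ)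
    (W : (Fin n → 𝕜) × (JetIndex n m → 𝕜) → Fin s → 𝕜) : Prop :=
  ∀ F : Filt 𝕜 n m d, ∀ (i : Fin s) (p : JetIndex n m),
    ∃ f : MvPowerSeries (Fin n) 𝕜,
      IsTaylorSeries f (fun x => jetPartial W i p (x, jet m F.1 x)) ∧
      (((p.2.1.degree : ℤ) + q + 1 - m p.1 - d).toNat : ℕ∞) ≤ f.order

/-- The norm `‖F ^ (i)‖` of the homogeneous part of degree `i` of a tuple: the maximum over the
components of the sums of the absolute values of the coefficients of degree `i`. -/
def homNorm {𝕜 : Type*} [RCLike 𝕜] {n k : ℕ} (i : ℕ) (F : Fin k → MvPowerSeries (Fin n) 𝕜) : ℝ :=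
  ⨆ j, ∑ α ∈ (Finset.univ : Finset (Fin n)).finsuppAntidiag i, ‖MvPowerSeries.coeff α (F j)‖

/-- The series `F̂ (z) = ∑ i, ‖F ^ (i)‖ z ^ i` in one variable. -/
def hat {𝕜 : Type*} [RCLike 𝕜] {n k : ℕ} (F : Fin k → MvPowerSeries (Fin n) 𝕜) : PowerSeries ℝ :=
  PowerSeries.mk fun i => homNorm i F

/-- The domination `F ≺ G` of series in one variable. Laurent series are allowed because the
exponent in `z ^ (q - d)` may be negative. -/
def Dominates (G F : LaurentSeries ℝ) : Prop :=
  ∀ k : ℤ, 0 ≤ G.coeff k ∧ |F.coeff k| ≤ G.coeff k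

/-- The series `d^l / dz^l (z ^ e * f)`. -/
def derivShift (l : ℕ) (e : ℤ) (f : PowerSeries ℝ) : LaurentSeries ℝ :=
  (LaurentSeries.derivative ℝ)^[l] (HahnSeries.single e (1 : ℝ) * HahnSeries.ofPowerSeries ℤ ℝ f)

end

end BigDenominators

open BigDenominators

/-! A solution is a fixed point of `Φ = S⁻¹ ∘ π ∘ T`. On differences, `T` raises the order by at
least `q - d + 1`, while the majorant hypothesis lets `S⁻¹ ∘ π` lower it by at most `q - d`. So `Φ`
contracts for the order, the iterates `Φ^k 0` stabilize coefficientwise, and only the convergence of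
their limit is at stake.

Convergence is measured by `wnorm ρ f = ∑ ‖f_α‖ ρ ^ |α|`. The map `T` consumes up to `m j`
derivatives of the component `j`, but `S⁻¹` divides the coefficients of degree `k` by roughly `k ^ m
j`: these are the big denominators. A bound on `degMul (m j)`, in which coefficients carry the
weight `(|α| + 1) ^ m j`, therefore survives an application of `Φ` at a fixed radius:
`wnorm_partialDeriv_mul_le` controls the derivatives that enter `T`, and `pow_mul_wnorm_degMul_le`
recovers the weight.

Let `F₀` be an iterate such that `Φ F₀ - F₀` has order at least a large `L`, and expand `W` around
the jet of `F₀`. If the weighted norms of `H` are at most `R ρ ^ (m j + L)`, the linear part of `T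
(F₀ + H) - T F₀` is `O(ρ ^ (L + q + 1 - d))`, since regularity makes its coefficients `∂W/∂u` vanish
to high order, and the rest is quadratic, hence `O(ρ ^ (2 L))` (`wnorm_comp_graphSubst_sub_le`,
`exists_wnorm_sub_le`). As `S⁻¹ ∘ π` contributes `ρ ^ (m j + d - q)`, the increment of `Φ` is `O(ρ ^
(m j + L + 1))`. The spare factor `ρ` keeps all later iterates in the ball once `ρ` is small, and
`exists_fixedPoint` concludes. -/

open scoped NNReal ENNReal

namespace BigDenominators

noncomputable section

/-! ### Weighted norms and sums of power series. -/

section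

variable {𝕜 : Type*} [RCLike 𝕜] {σ τ : Type*}

/-- The weighted `ℓ¹` norm `∑ ‖f_α‖ ρ ^ |α|` of a power series. -/
def wnorm (ρ : ℝ≥0) (f : MvPowerSeries σ 𝕜) : ℝ≥0∞ :=
  ∑' α : σ →₀ ℕ, ‖MvPowerSeries.coeff α f‖ₑ * (ρ : ℝ≥0∞) ^ α.degree

theorem wnorm_le_wnorm {ρ : ℝ≥0} {f g : MvPowerSeries σ 𝕜}
    (h : ∀ α, ‖MvPowerSeries.coeff α f‖ₑ ≤ ‖MvPowerSeries.coeff α g‖ₑ) :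
    wnorm ρ f ≤ wnorm ρ g :=
  ENNReal.tsum_le_tsum fun α => by gcongr; exact h α

theorem wnorm_mono {ρ ρ' : ℝ≥0} (h : ρ ≤ ρ') (f : MvPowerSeries σ 𝕜) :
    wnorm ρ f ≤ wnorm ρ' f :=
  ENNReal.tsum_le_tsum fun α => by gcongr

theorem wnorm_add_le (ρ : ℝ≥0) (f g : MvPowerSeries σ 𝕜) :
    wnorm ρ (f + g) ≤ wnorm ρ f + wnorm ρ g := by
  unfold wnorm
  rw [← ENNReal.tsum_add]
  refine ENNReal.tsum_le_tsum fun α => ?_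
  rw [← add_mul, map_add]
  gcongr
  exact enorm_add_le _ _

theorem wnorm_sub_le (ρ : ℝ≥0) (f g : MvPowerSeries σ 𝕜) :
    wnorm ρ (f - g) ≤ wnorm ρ f + wnorm ρ g := by
  unfold wnorm
  rw [← ENNReal.tsum_add]
  refine ENNReal.tsum_le_tsum fun α => ?_
  rw [← add_mul, map_sub]
  gcongr
  exact enorm_sub_le

theorem wnorm_zero (ρ : ℝ≥0) : wnorm ρ (0 : MvPowerSeries σ 𝕜) = 0 := by
  simp [wnorm]

theorem wnorm_monomial (ρ : ℝ≥0) (β : σ →₀ ℕ) (c : 𝕜) :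
    wnorm ρ (MvPowerSeries.monomial β c) = ‖c‖ₑ * (ρ : ℝ≥0∞) ^ β.degree := by
  classical
  unfold wnorm
  rw [tsum_eq_single β]
  · simp
  · intro α hα
    simp [MvPowerSeries.coeff_monomial, hα]

theorem wnorm_one (ρ : ℝ≥0) : wnorm ρ (1 : MvPowerSeries σ 𝕜) = 1 := by
  rw [← MvPowerSeries.monomial_zero_one, wnorm_monomial]
  simp

theorem wnorm_X (ρ : ℝ≥0) (i : σ) : wnorm ρ (MvPowerSeries.X i : MvPowerSeries σ 𝕜) = ρ := by
  rw [MvPowerSeries.X, wnorm_monomial]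
  simp

theorem tsum_sum_antidiagonal [DecidableEq σ] (F : (σ →₀ ℕ) × (σ →₀ ℕ) → ℝ≥0∞) :
    ∑' γ, ∑ p ∈ Finset.HasAntidiagonal.antidiagonal γ, F p = ∑' p, F p := by
  rw [← Finset.HasAntidiagonal.sigmaAntidiagonalEquivProd.tsum_eq, ENNReal.tsum_sigma']
  refine tsum_congr fun γ => ?_
  rw [tsum_fintype, ← Finset.sum_coe_sort]
  rfl

theorem wnorm_mul_le (ρ : ℝ≥0) (f g : MvPowerSeries σ 𝕜) :
    wnorm ρ (f * g) ≤ wnorm ρ f * wnorm ρ g := by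
  classical
  have h : ∀ a b : σ →₀ ℕ, (ρ : ℝ≥0∞) ^ (a + b).degree =
      (ρ : ℝ≥0∞) ^ a.degree * (ρ : ℝ≥0∞) ^ b.degree :=
    fun a b => by rw [map_add, pow_add]
  calc wnorm ρ (f * g)
      ≤ ∑' γ : σ →₀ ℕ, ∑ p ∈ Finset.HasAntidiagonal.antidiagonal γ,
        (‖MvPowerSeries.coeff p.1 f‖ₑ * (ρ : ℝ≥0∞) ^ p.1.degree) *
          (‖MvPowerSeries.coeff p.2 g‖ₑ * (ρ : ℝ≥0∞) ^ p.2.degree) := by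
        refine ENNReal.tsum_le_tsum fun γ => ?_
        rw [MvPowerSeries.coeff_mul]
        calc _ ≤ (∑ p ∈ Finset.HasAntidiagonal.antidiagonal γ, ‖MvPowerSeries.coeff p.1 f *
                MvPowerSeries.coeff p.2 g‖ₑ) * (ρ : ℝ≥0∞) ^ γ.degree := by
              gcongr
              exact enorm_sum_le _ _
          _ = _ := by
              rw [Finset.sum_mul]
              refine Finset.sum_congr rfl fun p hp => ?_
              rw [← Finset.HasAntidiagonal.mem_antidiagonal.1 hp, h, enorm_mul]
              ring
    _ = wnorm ρ f * wnorm ρ g := by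
        rw [tsum_sum_antidiagonal (F := fun p : (σ →₀ ℕ) × (σ →₀ ℕ) =>
          (‖MvPowerSeries.coeff p.1 f‖ₑ * (ρ : ℝ≥0∞) ^ p.1.degree) *
          (‖MvPowerSeries.coeff p.2 g‖ₑ * (ρ : ℝ≥0∞) ^ p.2.degree)),
          ENNReal.tsum_prod']
        simp_rw [ENNReal.tsum_mul_left, ENNReal.tsum_mul_right]
        rfl

theorem wnorm_pow_le (ρ : ℝ≥0) (f : MvPowerSeries σ 𝕜) (k : ℕ) :
    wnorm ρ (f ^ k) ≤ wnorm ρ f ^ k := by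
  induction k with
  | zero => simp [wnorm_one]
  | succ k ih =>
    rw [pow_succ, pow_succ]
    exact (wnorm_mul_le _ _ _).trans (by gcongr)

theorem wnorm_prod_le (ρ : ℝ≥0) (s : Finset τ) (f : τ → MvPowerSeries σ 𝕜) :
    wnorm ρ (∏ i ∈ s, f i) ≤ ∏ i ∈ s, wnorm ρ (f i) := by
  classical
  induction s using Finset.induction_on with
  | empty => simp [wnorm_one]
  | insert a s ha ih =>
    rw [Finset.prod_insert ha, Finset.prod_insert ha]
    exact (wnorm_mul_le _ _ _).trans (by gcongr)

theorem wnorm_pow_ne_top {ρ : ℝ≥0} {f : MvPowerSeries σ 𝕜} (hf : wnorm ρ f ≠ ⊤) (k : ℕ) :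
    wnorm ρ (f ^ k) ≠ ⊤ :=
  ne_top_of_le_ne_top (ENNReal.pow_ne_top hf) (wnorm_pow_le _ _ _)

theorem wnorm_prod_ne_top {ρ : ℝ≥0} (s : Finset τ) {f : τ → MvPowerSeries σ 𝕜}
    (hf : ∀ i, wnorm ρ (f i) ≠ ⊤) : wnorm ρ (∏ i ∈ s, f i) ≠ ⊤ :=
  ne_top_of_le_ne_top (ENNReal.prod_ne_top fun i _ => hf i) (wnorm_prod_le _ _ _)

/-- For `k ≥ e`, `ρ ^ k = (ρ / ρ₁) ^ k * ρ₁ ^ k ≤ (ρ / ρ₁) ^ e * ρ₁ ^ k`. This is how orders of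
vanishing become powers of a small radius. -/
theorem wnorm_le_of_le_order {ρ ρ₁ : ℝ≥0} (h : ρ ≤ ρ₁) (hρ₁ : ρ₁ ≠ 0) (f : MvPowerSeries σ 𝕜)
    {e : ℕ} (he : ∀ α : σ →₀ ℕ, α.degree < e → MvPowerSeries.coeff α f = 0) :
    wnorm ρ f ≤ ((ρ / ρ₁ : ℝ≥0) : ℝ≥0∞) ^ e * wnorm ρ₁ f := by
  unfold wnorm
  rw [← ENNReal.tsum_mul_left]
  refine ENNReal.tsum_le_tsum fun α => ?_
  by_cases hα : α.degree < e
  · simp [he α hα]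
  · have : (ρ : ℝ≥0∞) ^ α.degree ≤ ((ρ / ρ₁ : ℝ≥0) : ℝ≥0∞) ^ e * (ρ₁ : ℝ≥0∞) ^ α.degree := by
      rw [← ENNReal.coe_pow, ← ENNReal.coe_pow, ← ENNReal.coe_pow, ← ENNReal.coe_mul,
        ENNReal.coe_le_coe]
      have h1 : ρ ^ α.degree = (ρ / ρ₁) ^ α.degree * ρ₁ ^ α.degree := by
        rw [← mul_pow, div_mul_cancel₀ _ hρ₁]
      rw [h1]
      refine mul_le_mul' (pow_le_pow_of_le_one zero_le ?_ (not_lt.1 hα)) le_rfl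
      exact div_le_one_of_le₀ h zero_le
    calc _ ≤ ‖MvPowerSeries.coeff α f‖ₑ *
            (((ρ / ρ₁ : ℝ≥0) : ℝ≥0∞) ^ e * (ρ₁ : ℝ≥0∞) ^ α.degree) := by
          gcongr
      _ = _ := by ring

theorem enorm_coeff_mul_le_wnorm (ρ : ℝ≥0) (f : MvPowerSeries σ 𝕜) (α : σ →₀ ℕ) :
    ‖MvPowerSeries.coeff α f‖ₑ * (ρ : ℝ≥0∞) ^ α.degree ≤ wnorm ρ f :=
  ENNReal.le_tsum α

theorem summable_norm_coeff_mul {ρ : ℝ≥0} {f : MvPowerSeries σ 𝕜} (h : wnorm ρ f ≠ ⊤) :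
    Summable fun α : σ →₀ ℕ => ‖MvPowerSeries.coeff α f‖ * (ρ : ℝ) ^ α.degree := by
  have h1 := ENNReal.summable_toReal h
  refine h1.congr fun α => ?_
  simp

theorem isConvergent_iff {n : ℕ} {f : MvPowerSeries (Fin n) 𝕜} :
    IsConvergent f ↔ ∃ ρ : ℝ≥0, ρ ≠ 0 ∧ wnorm ρ f ≠ ⊤ := by
  constructor
  · rintro ⟨ρ, hρ, h⟩
    refine ⟨⟨ρ, hρ.le⟩, fun h0 => hρ.ne' (congrArg NNReal.toReal h0), ?_⟩
    have h2 := h.tsum_ofReal_ne_top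
    convert h2 using 1
    refine tsum_congr fun α => ?_
    rw [ENNReal.ofReal_mul (norm_nonneg _), ENNReal.ofReal_pow hρ.le, ofReal_norm]
    congr 2
    exact (ENNReal.ofReal_eq_coe_nnreal hρ.le).symm
  · rintro ⟨ρ, hρ, h⟩
    exact ⟨ρ, by positivity, summable_norm_coeff_mul h⟩

/-- The sum of a power series at a point, for an arbitrary finite set of variables. -/
def evalAt [Fintype σ] (f : MvPowerSeries σ 𝕜) (x : σ → 𝕜) : 𝕜 :=
  ∑' α : σ →₀ ℕ, MvPowerSeries.coeff α f * ∏ i, x i ^ α i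

section evalAt

variable [Fintype σ] {ρ : ℝ≥0} {x : σ → 𝕜}

theorem norm_prod_pow_le (hx : ∀ i, ‖x i‖ ≤ ρ) (α : σ →₀ ℕ) :
    ‖∏ i, x i ^ α i‖ ≤ (ρ : ℝ) ^ α.degree := by
  rw [norm_prod, Finsupp.degree_eq_sum, ← Finset.prod_pow_eq_pow_sum]
  refine Finset.prod_le_prod (fun i _ => norm_nonneg _) fun i _ => ?_
  rw [norm_pow]
  exact pow_le_pow_left₀ (norm_nonneg _) (hx i) _

theorem summable_norm_evalAt {f : MvPowerSeries σ 𝕜} (h : wnorm ρ f ≠ ⊤) (hx : ∀ i, ‖x i‖ ≤ ρ) :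
    Summable fun α : σ →₀ ℕ => ‖MvPowerSeries.coeff α f * ∏ i, x i ^ α i‖ := by
  refine Summable.of_nonneg_of_le (fun α => norm_nonneg _) (fun α => ?_)
    (summable_norm_coeff_mul h)
  rw [norm_mul]
  gcongr
  exact norm_prod_pow_le hx α

theorem summable_evalAt {f : MvPowerSeries σ 𝕜} (h : wnorm ρ f ≠ ⊤) (hx : ∀ i, ‖x i‖ ≤ ρ) :
    Summable fun α : σ →₀ ℕ => MvPowerSeries.coeff α f * ∏ i, x i ^ α i :=
  (summable_norm_evalAt h hx).of_norm

theorem enorm_evalAt_le (f : MvPowerSeries σ 𝕜) (hx : ∀ i, ‖x i‖ ≤ ρ) :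
    ‖evalAt f x‖ₑ ≤ wnorm ρ f := by
  refine (enorm_tsum_le_tsum_enorm).trans (ENNReal.tsum_le_tsum fun α => ?_)
  rw [enorm_mul]
  gcongr
  have := norm_prod_pow_le hx α
  rw [← ENNReal.coe_pow, enorm_eq_nnnorm, ENNReal.coe_le_coe]
  exact_mod_cast this

theorem evalAt_add {f g : MvPowerSeries σ 𝕜} (hf : wnorm ρ f ≠ ⊤) (hg : wnorm ρ g ≠ ⊤)
    (hx : ∀ i, ‖x i‖ ≤ ρ) : evalAt (f + g) x = evalAt f x + evalAt g x := by
  unfold evalAt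
  rw [← (summable_evalAt hf hx).tsum_add (summable_evalAt hg hx)]
  simp [add_mul]

theorem evalAt_sub {f g : MvPowerSeries σ 𝕜} (hf : wnorm ρ f ≠ ⊤) (hg : wnorm ρ g ≠ ⊤)
    (hx : ∀ i, ‖x i‖ ≤ ρ) : evalAt (f - g) x = evalAt f x - evalAt g x := by
  unfold evalAt
  rw [← (summable_evalAt hf hx).tsum_sub (summable_evalAt hg hx)]
  simp [sub_mul]

theorem evalAt_monomial (β : σ →₀ ℕ) (c : 𝕜) (x : σ → 𝕜) :
    evalAt (MvPowerSeries.monomial β c) x = c * ∏ i, x i ^ β i := by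
  classical
  unfold evalAt
  rw [tsum_eq_single β]
  · simp
  · intro α hα
    simp [MvPowerSeries.coeff_monomial, hα]

theorem evalAt_one (x : σ → 𝕜) : evalAt (1 : MvPowerSeries σ 𝕜) x = 1 := by
  rw [← MvPowerSeries.monomial_zero_one, evalAt_monomial]
  simp

theorem evalAt_X (i : σ) (x : σ → 𝕜) : evalAt (MvPowerSeries.X i : MvPowerSeries σ 𝕜) x = x i := by
  classical
  rw [MvPowerSeries.X, evalAt_monomial, one_mul, Finset.prod_eq_single i] <;>
    simp +contextual [eq_comm]

theorem evalAt_C (c : 𝕜) (x : σ → 𝕜) : evalAt (MvPowerSeries.C c : MvPowerSeries σ 𝕜) x = c := by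
  rw [← MvPowerSeries.monomial_zero_eq_C_apply, evalAt_monomial]
  simp

theorem evalAt_zero_right (f : MvPowerSeries σ 𝕜) :
    evalAt f 0 = MvPowerSeries.constantCoeff f := by
  unfold evalAt
  rw [tsum_eq_single 0]
  · simp
  · intro α hα
    obtain ⟨i, hi⟩ : ∃ i, α i ≠ 0 := by
      by_contra! h
      exact hα (Finsupp.ext h)
    rw [Finset.prod_eq_zero (Finset.mem_univ i) (by simp [hi]), mul_zero]

theorem evalAt_mul {f g : MvPowerSeries σ 𝕜} (hf : wnorm ρ f ≠ ⊤) (hg : wnorm ρ g ≠ ⊤)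
    (hx : ∀ i, ‖x i‖ ≤ ρ) : evalAt (f * g) x = evalAt f x * evalAt g x := by
  classical
  let a : (σ →₀ ℕ) → 𝕜 := fun α => MvPowerSeries.coeff α f * ∏ i, x i ^ α i
  let b : (σ →₀ ℕ) → 𝕜 := fun α => MvPowerSeries.coeff α g * ∏ i, x i ^ α i
  have ha : Summable fun α => ‖a α‖ := summable_norm_evalAt hf hx
  have hb : Summable fun α => ‖b α‖ := summable_norm_evalAt hg hx
  have h1 : (∑' α, a α) * ∑' α, b α =
      ∑' γ, ∑ p ∈ Finset.HasAntidiagonal.antidiagonal γ, a p.1 * b p.2 :=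
    ha.of_norm.tsum_mul_tsum_eq_tsum_sum_antidiagonal hb.of_norm
      (summable_mul_of_summable_norm ha hb)
  refine Eq.trans (tsum_congr fun γ => ?_) h1.symm
  rw [MvPowerSeries.coeff_mul, Finset.sum_mul]
  refine Finset.sum_congr rfl fun p hp => ?_
  have h2 : ∏ i, x i ^ γ i = (∏ i, x i ^ p.1 i) * ∏ i, x i ^ p.2 i := by
    rw [← Finset.prod_mul_distrib, ← Finset.HasAntidiagonal.mem_antidiagonal.1 hp]
    simp only [Finsupp.add_apply, pow_add]
  simp only [a, b, h2]
  ring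

theorem evalAt_pow {f : MvPowerSeries σ 𝕜} (hf : wnorm ρ f ≠ ⊤)
    (hx : ∀ i, ‖x i‖ ≤ ρ) (k : ℕ) : evalAt (f ^ k) x = evalAt f x ^ k := by
  induction k with
  | zero => simp [evalAt_one]
  | succ k ih => rw [pow_succ, pow_succ, evalAt_mul (wnorm_pow_ne_top hf k) hf hx, ih]

theorem evalAt_prod (s : Finset τ) {f : τ → MvPowerSeries σ 𝕜} (hf : ∀ i, wnorm ρ (f i) ≠ ⊤)
    (hx : ∀ i, ‖x i‖ ≤ ρ) : evalAt (∏ i ∈ s, f i) x = ∏ i ∈ s, evalAt (f i) x := by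
  classical
  induction s using Finset.induction_on with
  | empty => simp [evalAt_one]
  | insert a s ha ih =>
    rw [Finset.prod_insert ha, Finset.prod_insert ha, evalAt_mul (hf a) (wnorm_prod_ne_top s hf) hx,
      ih]

theorem eventually_norm_le (hρ : ρ ≠ 0) : ∀ᶠ y in 𝓝 (0 : σ → 𝕜), ∀ i, ‖y i‖ ≤ ρ := by
  have : (0 : ℝ) < ρ := by positivity
  filter_upwards [Metric.closedBall_mem_nhds (0 : σ → 𝕜) this] with y hy i
  rw [mem_closedBall_zero_iff] at hy
  exact (norm_le_pi_norm y i).trans hy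

theorem tendsto_evalAt {f : MvPowerSeries σ 𝕜} (hρ : ρ ≠ 0) (hf : wnorm ρ f ≠ ⊤) :
    Tendsto (evalAt f) (𝓝 0) (𝓝 (evalAt f 0)) := by
  unfold evalAt
  refine tendsto_tsum_of_dominated_convergence (summable_norm_coeff_mul hf) (fun α => ?_) ?_
  · refine Continuous.tendsto' (by fun_prop) _ _ ?_
    simp
  · filter_upwards [eventually_norm_le (𝕜 := 𝕜) (σ := σ) hρ] with y hy α
    rw [norm_mul]
    gcongr
    exact norm_prod_pow_le hy α

end evalAt

end

/-! ### Infinite sums, composition and the identity theorem. -/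

section

variable {𝕜 : Type*} [RCLike 𝕜] {σ τ B : Type*}

theorem summable_of_tsum_enorm_ne_top {f : B → 𝕜} (h : ∑' b, ‖f b‖ₑ ≠ ⊤) : Summable f :=
  Summable.of_nnnorm (ENNReal.tsum_coe_ne_top_iff_summable.1 h)

/-- The coefficientwise sum of a family of power series. -/
def seriesSum (g : B → MvPowerSeries σ 𝕜) : MvPowerSeries σ 𝕜 :=
  fun γ => ∑' b, MvPowerSeries.coeff γ (g b)

theorem coeff_seriesSum (g : B → MvPowerSeries σ 𝕜) (γ : σ →₀ ℕ) :
    MvPowerSeries.coeff γ (seriesSum g) = ∑' b, MvPowerSeries.coeff γ (g b) := rfl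

theorem wnorm_seriesSum_le (ρ : ℝ≥0) (g : B → MvPowerSeries σ 𝕜) :
    wnorm ρ (seriesSum g) ≤ ∑' b, wnorm ρ (g b) := by
  unfold wnorm
  rw [ENNReal.tsum_comm]
  refine ENNReal.tsum_le_tsum fun γ => ?_
  rw [ENNReal.tsum_mul_right]
  gcongr
  exact enorm_tsum_le_tsum_enorm

theorem summable_coeff {ρ : ℝ≥0} (hρ : ρ ≠ 0) {g : B → MvPowerSeries σ 𝕜}
    (h : ∑' b, wnorm ρ (g b) ≠ ⊤) (γ : σ →₀ ℕ) :
    Summable fun b => MvPowerSeries.coeff γ (g b) := by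
  have h1 : Summable fun b => MvPowerSeries.coeff γ (g b) * ((ρ : ℝ) : 𝕜) ^ γ.degree := by
    refine summable_of_tsum_enorm_ne_top (ne_top_of_le_ne_top h (ENNReal.tsum_le_tsum fun b => ?_))
    refine le_trans (le_of_eq ?_) (enorm_coeff_mul_le_wnorm ρ (g b) γ)
    rw [enorm_mul, enorm_pow]
    congr 2
    simp [enorm_eq_nnnorm]
  refine (summable_mul_right_iff ?_).1 h1
  exact pow_ne_zero _ (by simpa using hρ)

theorem seriesSum_sub {ρ : ℝ≥0} (hρ : ρ ≠ 0) {g g' : B → MvPowerSeries σ 𝕜}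
    (h : ∑' b, wnorm ρ (g b) ≠ ⊤) (h' : ∑' b, wnorm ρ (g' b) ≠ ⊤) :
    seriesSum g - seriesSum g' = seriesSum fun b => g b - g' b := by
  ext γ
  simp only [map_sub, coeff_seriesSum]
  exact ((summable_coeff hρ h γ).tsum_sub (summable_coeff hρ h' γ)).symm

theorem evalAt_seriesSum [Fintype σ] {ρ : ℝ≥0} {g : B → MvPowerSeries σ 𝕜} {x : σ → 𝕜}
    (h : ∑' b, wnorm ρ (g b) ≠ ⊤) (hx : ∀ i, ‖x i‖ ≤ ρ) :
    evalAt (seriesSum g) x = ∑' b, evalAt (g b) x := by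
  unfold evalAt
  simp_rw [coeff_seriesSum, ← tsum_mul_right]
  refine Summable.tsum_comm (f := fun b (γ : σ →₀ ℕ) =>
    MvPowerSeries.coeff γ (g b) * ∏ i, x i ^ γ i) ?_
  refine summable_of_tsum_enorm_ne_top (ne_top_of_le_ne_top h ?_)
  rw [ENNReal.tsum_prod']
  refine ENNReal.tsum_le_tsum fun b => ENNReal.tsum_le_tsum fun γ => ?_
  simp only [Function.uncurry]
  rw [enorm_mul]
  gcongr
  have := norm_prod_pow_le hx γ
  rw [← ENNReal.coe_pow, enorm_eq_nnnorm, ENNReal.coe_le_coe]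
  exact_mod_cast this

/-- The terms of the composition of a power series with a family of power series. -/
def compTerm [Fintype τ] (c : MvPowerSeries τ 𝕜) (h : τ → MvPowerSeries σ 𝕜) (β : τ →₀ ℕ) :
    MvPowerSeries σ 𝕜 :=
  MvPowerSeries.C (MvPowerSeries.coeff β c) * ∏ i, h i ^ β i

/-- The composition of a power series with a family of power series. -/
def comp [Fintype τ] (c : MvPowerSeries τ 𝕜) (h : τ → MvPowerSeries σ 𝕜) : MvPowerSeries σ 𝕜 :=
  seriesSum (compTerm c h)

theorem wnorm_C (ρ : ℝ≥0) (c : 𝕜) : wnorm ρ (MvPowerSeries.C c : MvPowerSeries σ 𝕜) = ‖c‖ₑ := by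
  rw [← MvPowerSeries.monomial_zero_eq_C_apply, wnorm_monomial]
  simp

theorem wnorm_compTerm_le_prod [Fintype τ] (ρ : ℝ≥0) (c : MvPowerSeries τ 𝕜)
    (h : τ → MvPowerSeries σ 𝕜) (β : τ →₀ ℕ) :
    wnorm ρ (compTerm c h β) ≤ ‖MvPowerSeries.coeff β c‖ₑ * ∏ i, wnorm ρ (h i) ^ β i := by
  refine (wnorm_mul_le _ _ _).trans ?_
  rw [wnorm_C]
  gcongr
  refine (wnorm_prod_le _ _ _).trans (Finset.prod_le_prod' fun i _ => wnorm_pow_le _ _ _)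

theorem wnorm_compTerm_le [Fintype τ] {ρ ρ' : ℝ≥0} (c : MvPowerSeries τ 𝕜)
    {h : τ → MvPowerSeries σ 𝕜} (hh : ∀ i, wnorm ρ (h i) ≤ ρ') (β : τ →₀ ℕ) :
    wnorm ρ (compTerm c h β) ≤ ‖MvPowerSeries.coeff β c‖ₑ * (ρ' : ℝ≥0∞) ^ β.degree := by
  refine (wnorm_compTerm_le_prod _ _ _ _).trans ?_
  gcongr
  rw [Finsupp.degree_eq_sum, ← Finset.prod_pow_eq_pow_sum]
  exact Finset.prod_le_prod' fun i _ => pow_le_pow_left' (hh i) _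

/-- By submultiplicativity of the norm, inner series of norm at most `ρ'` act like points of the
polydisc of radius `ρ'`; this settles convergence for all compositions below. -/
theorem tsum_wnorm_compTerm_le [Fintype τ] {ρ ρ' : ℝ≥0} (c : MvPowerSeries τ 𝕜)
    {h : τ → MvPowerSeries σ 𝕜} (hh : ∀ i, wnorm ρ (h i) ≤ ρ') :
    ∑' β, wnorm ρ (compTerm c h β) ≤ wnorm ρ' c :=
  ENNReal.tsum_le_tsum fun β => wnorm_compTerm_le c hh β

theorem wnorm_comp_le [Fintype τ] {ρ ρ' : ℝ≥0} (c : MvPowerSeries τ 𝕜)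
    {h : τ → MvPowerSeries σ 𝕜} (hh : ∀ i, wnorm ρ (h i) ≤ ρ') :
    wnorm ρ (comp c h) ≤ wnorm ρ' c :=
  (wnorm_seriesSum_le _ _).trans (tsum_wnorm_compTerm_le c hh)

theorem evalAt_comp [Fintype σ] [Fintype τ] {ρ ρ' : ℝ≥0} {c : MvPowerSeries τ 𝕜}
    (hc : wnorm ρ' c ≠ ⊤) {h : τ → MvPowerSeries σ 𝕜} (hh : ∀ i, wnorm ρ (h i) ≤ ρ')
    {x : σ → 𝕜} (hx : ∀ i, ‖x i‖ ≤ ρ) :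
    evalAt (comp c h) x = evalAt c fun i => evalAt (h i) x := by
  have hh' : ∀ i, wnorm ρ (h i) ≠ ⊤ := fun i => ne_top_of_le_ne_top ENNReal.coe_ne_top (hh i)
  unfold comp
  rw [evalAt_seriesSum (ne_top_of_le_ne_top hc (tsum_wnorm_compTerm_le c hh)) hx]
  refine tsum_congr fun β => ?_
  unfold compTerm
  rw [evalAt_mul (ρ := ρ) (by rw [wnorm_C]; exact enorm_ne_top)
    (wnorm_prod_ne_top _ fun i => wnorm_pow_ne_top (hh' i) _) hx, evalAt_C,
    evalAt_prod _ (fun i => wnorm_pow_ne_top (hh' i) _) hx]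
  simp_rw [evalAt_pow (hh' _) hx]

/-- A convergent power series whose sum vanishes near the origin is zero. -/
theorem eq_zero_of_eventually_evalAt_eq_zero [Fintype σ] {ρ : ℝ≥0} (hρ : ρ ≠ 0)
    {f : MvPowerSeries σ 𝕜} (hf : wnorm ρ f ≠ ⊤) (h : ∀ᶠ x in 𝓝 (0 : σ → 𝕜), evalAt f x = 0) :
    f = 0 := by
  classical
  let D : ℕ → Finset (σ →₀ ℕ) := fun k => (Finsupp.finite_of_degree_eq (σ := σ) k).toFinset
  let P : ℕ → MvPolynomial σ 𝕜 := fun k =>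
    ∑ α ∈ D k, MvPolynomial.monomial α (MvPowerSeries.coeff α f)
  have hD : ∀ k α, α ∈ D k ↔ α.degree = k := fun k α => by simp [D]
  -- Along the line `t ↦ t • y` the sum is a one-variable series in `t` whose coefficients are the
  -- values at `y` of the homogeneous parts. They all vanish, and a polynomial vanishing everywhere
  -- on the infinite field `𝕜` is zero.
  have hP : ∀ k, P k = 0 := by
    intro k
    refine MvPolynomial.funext fun y => ?_
    have key : HasFPowerSeriesAt (0 : 𝕜 → 𝕜)
        (FormalMultilinearSeries.ofScalars 𝕜 fun k => MvPolynomial.eval y (P k)) 0 := by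
      rw [hasFPowerSeriesAt_iff]
      have hty : Tendsto (fun t : 𝕜 => t • y) (𝓝 0) (𝓝 0) :=
        Continuous.tendsto' (by fun_prop) _ _ (by simp)
      filter_upwards [hty.eventually (eventually_norm_le (𝕜 := 𝕜) (σ := σ) hρ), hty.eventually h]
        with t ht ht0
      have hs := (summable_evalAt hf ht).hasSum
      change HasSum _ (evalAt f (t • y)) at hs
      rw [ht0, ← (Equiv.sigmaFiberEquiv (fun α : σ →₀ ℕ => α.degree)).hasSum_iff] at hs
      refine hs.sigma fun k => ?_
      rw [FormalMultilinearSeries.coeff_ofScalars]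
      have h2 : t ^ k • MvPolynomial.eval y (P k) =
          ∑ α ∈ D k, MvPowerSeries.coeff α f * ∏ i, (t • y) i ^ α i := by
        simp only [P, map_sum, MvPolynomial.eval_monomial, smul_eq_mul, Finset.mul_sum]
        refine Finset.sum_congr rfl fun α hα => ?_
        rw [← (hD k α).1 hα, Finsupp.degree_eq_sum, ← Finset.prod_pow_eq_pow_sum,
          Finsupp.prod_fintype _ _ (by simp)]
        simp only [Pi.smul_apply, smul_eq_mul, mul_pow, Finset.prod_mul_distrib]
        ring
      rw [h2]
      have h3 := (D k).hasSum (fun α => MvPowerSeries.coeff α f * ∏ i, (t • y) i ^ α i)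
      exact (Equiv.hasSum_iff (Equiv.subtypeEquivRight fun α => (hD k α).symm :
        {α : σ →₀ ℕ // α.degree = k} ≃ {α // α ∈ D k})).2 h3
    have h0 := key.eq_zero
    have h1 := congrArg (fun p => FormalMultilinearSeries.coeff p k) h0
    rw [FormalMultilinearSeries.coeff_ofScalars] at h1
    rw [h1, map_zero]
    rfl
  ext α
  have h1 := congrArg (MvPolynomial.coeff α) (hP α.degree)
  simpa [P, MvPolynomial.coeff_sum, MvPolynomial.coeff_monomial, hD] using h1

theorem eq_of_eventually_evalAt_eq [Fintype σ] {ρ : ℝ≥0} (hρ : ρ ≠ 0)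
    {f g : MvPowerSeries σ 𝕜} (hf : wnorm ρ f ≠ ⊤) (hg : wnorm ρ g ≠ ⊤)
    (h : ∀ᶠ x in 𝓝 (0 : σ → 𝕜), evalAt f x = evalAt g x) : f = g := by
  rw [← sub_eq_zero]
  refine eq_zero_of_eventually_evalAt_eq_zero hρ (ne_top_of_le_ne_top
    (ENNReal.add_ne_top.2 ⟨hf, hg⟩) (wnorm_sub_le ρ f g)) ?_
  filter_upwards [h, eventually_norm_le (𝕜 := 𝕜) (σ := σ) hρ] with x hx hx'
  rw [evalAt_sub hf hg hx', hx, sub_self]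

end

/-! ### Analytic functions as power series, and their linear parts. -/

section

variable {𝕜 : Type*} [RCLike 𝕜]

theorem apply_const_eq_sum {σ : Type*} [Fintype σ] [DecidableEq σ] {k : ℕ}
    (p : ContinuousMultilinearMap 𝕜 (fun _ : Fin k => σ → 𝕜) 𝕜) (y : σ → 𝕜) :
    p (fun _ => y) = ∑ c : Fin k → σ, p (fun i => Pi.single (c i) 1) * ∏ i, y (c i) := by
  conv_lhs => rw [pi_eq_sum_univ' y]
  rw [p.map_sum]
  refine Finset.sum_congr rfl fun c _ => ?_
  rw [p.map_smul_univ (fun i => y (c i)) fun i => Pi.single (c i) (1 : 𝕜), smul_eq_mul, mul_comm]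

/-- An analytic function at the origin is the sum of a convergent power series. -/
theorem exists_wnorm_ne_top_of_analyticAt {σ : Type*} [Fintype σ] {g : (σ → 𝕜) → 𝕜}
    (hg : AnalyticAt 𝕜 g 0) :
    ∃ (w : MvPowerSeries σ 𝕜) (ρ : ℝ≥0), ρ ≠ 0 ∧ wnorm ρ w ≠ ⊤ ∧
      ∀ᶠ y in 𝓝 (0 : σ → 𝕜), g y = evalAt w y := by
  classical
  obtain ⟨p, r, hp⟩ := hg
  obtain ⟨r₀, hr₀, hr₀r⟩ := ENNReal.lt_iff_exists_nnreal_btwn.1 hp.r_pos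
  have hr₀' : r₀ ≠ 0 := by
    rintro rfl
    simp at hr₀
  obtain ⟨C, hC, hpC⟩ := p.norm_mul_pow_le_of_lt_radius (hr₀r.trans_le hp.r_le)
  let N : ℝ≥0 := Fintype.card σ
  -- There are `N ^ k` words of length `k` in the variables; with this radius `N * ρ ≤ r₀ / 2`, so
  -- they contribute at most `C / 2 ^ k` together.
  let ρ : ℝ≥0 := r₀ / (2 * (N + 1))
  have hN : (2 * (N + 1)) ≠ 0 := by positivity
  have hρ : ρ ≠ 0 := div_ne_zero hr₀' hN
  -- Expanding `p k (y, …, y)` in coordinates gives one monomial per word; `seriesSum` collects the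
  -- words with equal exponents.
  let G : (Σ k : ℕ, (Fin k → σ)) → MvPowerSeries σ 𝕜 := fun b =>
    MvPowerSeries.monomial (∑ i, Finsupp.single (b.2 i) 1) (p b.1 fun i => Pi.single (b.2 i) 1)
  have hG : ∀ b, wnorm ρ (G b) ≤ ‖p b.1‖ₑ * (ρ : ℝ≥0∞) ^ b.1 := by
    intro b
    rw [wnorm_monomial, map_sum]
    simp only [Finsupp.degree_single, Finset.sum_const, Finset.card_univ, Fintype.card_fin,
      smul_eq_mul, mul_one]
    gcongr
    rw [enorm_eq_nnnorm, enorm_eq_nnnorm, ENNReal.coe_le_coe, ← NNReal.coe_le_coe, coe_nnnorm,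
      coe_nnnorm]
    refine ((p b.1).le_opNorm _).trans ?_
    refine mul_le_of_le_one_right (norm_nonneg _) (Finset.prod_le_one (fun _ _ => norm_nonneg _)
      fun i _ => ?_)
    rw [Pi.norm_single, norm_one]
  have hsum : ∑' b, wnorm ρ (G b) ≠ ⊤ := by
    have h1 : ∀ k : ℕ, (N : ℝ≥0∞) ^ k * (‖p k‖ₑ * (ρ : ℝ≥0∞) ^ k) ≤
        ((C.toNNReal * (1 / 2) ^ k : ℝ≥0) : ℝ≥0∞) := by
      intro k
      rw [enorm_eq_nnnorm, ← ENNReal.coe_pow, ← ENNReal.coe_pow, ← ENNReal.coe_mul,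
        ← ENNReal.coe_mul, ENNReal.coe_le_coe]
      have h2 : ‖p k‖₊ * r₀ ^ k ≤ C.toNNReal := by
        rw [← NNReal.coe_le_coe, Real.coe_toNNReal _ hC.le]
        exact hpC k
      have h3 : N * ρ ≤ r₀ * (1 / 2) := by
        have : N * ρ * (2 * (N + 1)) ≤ r₀ * (1 / 2) * (2 * (N + 1)) := by
          simp only [ρ]
          rw [mul_assoc, div_mul_cancel₀ _ hN]
          calc N * r₀ ≤ (N + 1) * r₀ := by gcongr; exact le_self_add
            _ = _ := by rw [mul_mul_mul_comm]; norm_num; ring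
        exact le_of_mul_le_mul_right this (by positivity)
      calc N ^ k * (‖p k‖₊ * ρ ^ k) = ‖p k‖₊ * (N * ρ) ^ k := by rw [mul_pow]; ring
        _ ≤ ‖p k‖₊ * (r₀ * (1 / 2)) ^ k := by gcongr
        _ = ‖p k‖₊ * r₀ ^ k * (1 / 2) ^ k := by rw [mul_pow]; ring
        _ ≤ _ := by gcongr
    have h4 : ∑' b, wnorm ρ (G b) ≤ ∑' k : ℕ, ((C.toNNReal * (1 / 2) ^ k : ℝ≥0) : ℝ≥0∞) := by
      rw [ENNReal.tsum_sigma']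
      refine ENNReal.tsum_le_tsum fun k => ?_
      refine (ENNReal.tsum_le_tsum (g := fun _ => ‖p k‖ₑ * (ρ : ℝ≥0∞) ^ k)
        fun c => hG ⟨k, c⟩).trans ?_
      refine le_trans (le_of_eq ?_) (h1 k)
      rw [tsum_fintype, Finset.sum_const, nsmul_eq_mul, Finset.card_univ, Fintype.card_fun,
        Fintype.card_fin]
      simp [N]
    refine ne_top_of_le_ne_top ?_ h4
    rw [ENNReal.tsum_coe_ne_top_iff_summable]
    refine Summable.mul_left _ ?_
    rw [← NNReal.summable_coe]
    simpa using summable_geometric_two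
  refine ⟨seriesSum G, ρ, hρ, ne_top_of_le_ne_top hsum (wnorm_seriesSum_le _ _), ?_⟩
  have hball : ∀ᶠ y in 𝓝 (0 : σ → 𝕜), y ∈ Metric.eball (0 : σ → 𝕜) r :=
    Metric.eball_mem_nhds _ hp.r_pos
  filter_upwards [hball, eventually_norm_le (𝕜 := 𝕜) (σ := σ) hρ] with y hy hy'
  rw [evalAt_seriesSum hsum hy']
  have h1 := (hp.hasSum hy).tsum_eq
  rw [zero_add] at h1
  rw [← h1]
  have hmon : ∀ b, evalAt (G b) y =
      (p b.1 fun i => Pi.single (b.2 i) 1) * ∏ i, y (b.2 i) := by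
    intro b
    rw [evalAt_monomial]
    congr 1
    have : ∀ j, y j ^ (∑ i, Finsupp.single (b.2 i) 1 : σ →₀ ℕ) j =
        ∏ i, y j ^ (if b.2 i = j then 1 else 0) := by
      intro j
      rw [Finsupp.finsetSum_apply, ← Finset.prod_pow_eq_pow_sum]
      simp only [Finsupp.single_apply]
    simp_rw [this]
    rw [Finset.prod_comm]
    refine Finset.prod_congr rfl fun i _ => ?_
    simp
  have hs : Summable fun b => evalAt (G b) y := by
    refine summable_of_tsum_enorm_ne_top (ne_top_of_le_ne_top hsum
      (ENNReal.tsum_le_tsum fun b => enorm_evalAt_le (G b) hy'))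
  rw [hs.tsum_sigma' fun k => (hasSum_fintype _).summable]
  refine tsum_congr fun k => ?_
  rw [tsum_fintype, apply_const_eq_sum]
  exact Finset.sum_congr rfl fun c _ => (hmon ⟨k, c⟩).symm

section linearPart

variable {ι κ : Type*}

theorem degree_sumElim [Fintype ι] [Fintype κ] (α : ι →₀ ℕ) (β : κ →₀ ℕ) :
    (Finsupp.sumElim α β).degree = α.degree + β.degree := by
  simp [Finsupp.degree_eq_sum, Fintype.sum_sum_type]

/-- The part of a power series in two groups of variables `x`, `v` that is linear in `v_p` and
constant in the other variables `v`, as a power series in `x`. -/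
def linearPart (p : κ) (c : MvPowerSeries (ι ⊕ κ) 𝕜) : MvPowerSeries ι 𝕜 :=
  fun α => MvPowerSeries.coeff (Finsupp.sumElim α (Finsupp.single p 1)) c

theorem coeff_linearPart (p : κ) (c : MvPowerSeries (ι ⊕ κ) 𝕜) (α : ι →₀ ℕ) :
    MvPowerSeries.coeff α (linearPart p c) =
      MvPowerSeries.coeff (Finsupp.sumElim α (Finsupp.single p 1)) c := rfl

theorem injective_sumElim (β : κ →₀ ℕ) :
    Function.Injective fun α : ι →₀ ℕ => Finsupp.sumElim α β := by
  intro α α' h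
  ext i
  simpa using DFunLike.congr_fun h (Sum.inl i)

theorem wnorm_linearPart_ne_top [Fintype ι] [Fintype κ] {ρ : ℝ≥0} (hρ : ρ ≠ 0) (p : κ)
    {c : MvPowerSeries (ι ⊕ κ) 𝕜}
    (hc : wnorm ρ c ≠ ⊤) : wnorm ρ (linearPart p c) ≠ ⊤ := by
  have h : wnorm ρ (linearPart p c) * ρ ≤ wnorm ρ c := by
    unfold wnorm
    rw [← ENNReal.tsum_mul_right]
    refine le_trans (le_of_eq (tsum_congr fun α => ?_))
      (ENNReal.tsum_comp_le_tsum_of_injective (injective_sumElim (Finsupp.single p 1)) _)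
    rw [coeff_linearPart, degree_sumElim, Finsupp.degree_single, pow_succ, mul_assoc]
  intro htop
  rw [htop, ENNReal.top_mul (by simpa using hρ)] at h
  exact hc (top_le_iff.1 h)

variable [Fintype ι] [Fintype κ]

/-- Once the constant and linear terms in `t` are removed, each remaining monomial has degree at
least two in `t`, so it is at most `‖t‖² / ρ²` times the corresponding term of `wnorm ρ c`.
Summation gives an error `O(t²)`. -/
theorem hasDerivAt_evalAt_sumElim [DecidableEq κ] {ρ : ℝ≥0} (hρ : ρ ≠ 0) (p : κ)
    {c : MvPowerSeries (ι ⊕ κ) 𝕜} (hc : wnorm ρ c ≠ ⊤) {x : ι → 𝕜} (hx : ∀ i, ‖x i‖ ≤ ρ) :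
    HasDerivAt (fun t => evalAt c (Sum.elim x (Pi.single p t))) (evalAt (linearPart p c) x) 0 := by
  classical
  have hρ' : (0 : ℝ) < ρ := by positivity
  let z : 𝕜 → ι ⊕ κ → 𝕜 := fun t => Sum.elim x (Pi.single p t)
  -- The coefficient of `t` in the term of index `β`.
  let a : (ι ⊕ κ →₀ ℕ) → 𝕜 := fun β =>
    if ∀ k, β (Sum.inr k) = (Finsupp.single p 1 : κ →₀ ℕ) k then
      MvPowerSeries.coeff β c * ∏ i, x i ^ β (Sum.inl i) else 0
  have ha_supp : Function.support a ⊆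
      Set.range fun α : ι →₀ ℕ => Finsupp.sumElim α (Finsupp.single p 1) := by
    intro β hβ
    have hβ' : ∀ k, β (Sum.inr k) = (Finsupp.single p 1 : κ →₀ ℕ) k := by
      by_contra hne
      exact hβ (if_neg hne)
    refine ⟨Finsupp.comapDomain Sum.inl β Sum.inl_injective.injOn, ?_⟩
    ext (i | k)
    · simp
    · simp [hβ']
  have ha_comp : ∀ α : ι →₀ ℕ, a (Finsupp.sumElim α (Finsupp.single p 1)) =
      MvPowerSeries.coeff α (linearPart p c) * ∏ i, x i ^ α i := by
    intro α
    simp [a, coeff_linearPart]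
  have ha_sum : Summable a := by
    rw [← (injective_sumElim (Finsupp.single p 1)).summable_iff fun β hβ => by
      by_contra hne
      exact hβ (ha_supp hne)]
    exact (summable_evalAt (wnorm_linearPart_ne_top hρ p hc) hx).congr fun α => (ha_comp α).symm
  have ha_tsum : ∑' β, a β = evalAt (linearPart p c) x := by
    rw [← (injective_sumElim (Finsupp.single p 1)).tsum_eq ha_supp]
    exact tsum_congr ha_comp
  have hz : ∀ t : 𝕜, ‖t‖ ≤ ρ → ∀ i, ‖z t i‖ ≤ ρ := by
    rintro t ht (i | k)
    · exact hx i
    · by_cases hk : k = p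
      · subst hk
        simpa [z] using ht
      · simp [z, hk]
  have hprod : ∀ (β : ι ⊕ κ →₀ ℕ) (t : 𝕜), ∏ i, z t i ^ β i =
      (∏ i, x i ^ β (Sum.inl i)) * ∏ k, (Pi.single p t : κ → 𝕜) k ^ β (Sum.inr k) := by
    intro β t
    simp [z, Fintype.prod_sum_type]
  have hprod' : ∀ (β : ι ⊕ κ →₀ ℕ) (t : 𝕜), ∏ k, (Pi.single p t : κ → 𝕜) k ^ β (Sum.inr k) =
      if ∀ k, k ≠ p → β (Sum.inr k) = 0 then t ^ β (Sum.inr p) else 0 := by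
    intro β t
    split_ifs with h
    · rw [Finset.prod_eq_single p]
      · simp
      · intro k _ hk
        simp [h k hk]
      · simp
    · push Not at h
      obtain ⟨k, hk, hk'⟩ := h
      exact Finset.prod_eq_zero (Finset.mem_univ k) (by simp [hk, hk'])
  have hbound : ∀ t : 𝕜, ‖t‖ ≤ ρ → ∀ β,
      ‖MvPowerSeries.coeff β c * ∏ i, z t i ^ β i - MvPowerSeries.coeff β c * ∏ i, z 0 i ^ β i
        - t * a β‖ ≤ ‖t‖ ^ 2 * ((ρ : ℝ) ^ 2)⁻¹ *
          (‖MvPowerSeries.coeff β c‖ * (ρ : ℝ) ^ β.degree) := by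
    intro t ht β
    have hnonneg : 0 ≤ ‖t‖ ^ 2 * ((ρ : ℝ) ^ 2)⁻¹ *
          (‖MvPowerSeries.coeff β c‖ * (ρ : ℝ) ^ β.degree) := by positivity
    rw [hprod, hprod, hprod', hprod']
    by_cases h : ∀ k, k ≠ p → β (Sum.inr k) = 0
    · rw [if_pos h, if_pos h]
      have hiff : (∀ k, β (Sum.inr k) = (Finsupp.single p 1 : κ →₀ ℕ) k) ↔ β (Sum.inr p) = 1 := by
        constructor
        · intro h1
          simpa using h1 p
        · intro h1 k
          by_cases hk : k = p
          · subst hk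
            simpa using h1
          · rw [h k hk, Finsupp.single_eq_of_ne hk]
      simp only [a, hiff]
      rcases Nat.lt_or_ge (β (Sum.inr p)) 2 with h2 | h2
      · have h3 : β (Sum.inr p) = 0 ∨ β (Sum.inr p) = 1 := by omega
        rcases h3 with h3 | h3
        · simpa [h3] using hnonneg
        · rw [h3, if_pos rfl]
          convert hnonneg using 1
          rw [norm_eq_zero]
          ring
      · rw [if_neg (by omega), mul_zero, sub_zero, zero_pow (by omega), mul_zero, mul_zero,
          sub_zero]
        have hdeg : β.degree = ∑ i, β (Sum.inl i) + β (Sum.inr p) := by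
          rw [Finsupp.degree_eq_sum, Fintype.sum_sum_type]
          congr 1
          exact Finset.sum_eq_single p (fun k _ hk => h k hk) (by simp)
        have h4 : ‖∏ i, x i ^ β (Sum.inl i)‖ ≤ (ρ : ℝ) ^ ∑ i, β (Sum.inl i) := by
          rw [norm_prod, ← Finset.prod_pow_eq_pow_sum]
          refine Finset.prod_le_prod (fun i _ => norm_nonneg _) fun i _ => ?_
          rw [norm_pow]
          exact pow_le_pow_left₀ (norm_nonneg _) (hx i) _
        have h5 : ‖t‖ ^ β (Sum.inr p) ≤ ‖t‖ ^ 2 * ((ρ : ℝ) ^ 2)⁻¹ * (ρ : ℝ) ^ β (Sum.inr p) := by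
          obtain ⟨l, hl⟩ := Nat.exists_eq_add_of_le h2
          rw [hl, pow_add, pow_add]
          calc ‖t‖ ^ 2 * ‖t‖ ^ l ≤ ‖t‖ ^ 2 * (ρ : ℝ) ^ l := by gcongr
            _ = _ := by field_simp
        calc _ = ‖MvPowerSeries.coeff β c‖ * (‖∏ i, x i ^ β (Sum.inl i)‖ *
              ‖t‖ ^ β (Sum.inr p)) := by rw [norm_mul, norm_mul, norm_pow]
          _ ≤ ‖MvPowerSeries.coeff β c‖ * ((ρ : ℝ) ^ (∑ i, β (Sum.inl i)) *
              (‖t‖ ^ 2 * ((ρ : ℝ) ^ 2)⁻¹ * (ρ : ℝ) ^ β (Sum.inr p))) := by gcongr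
          _ = _ := by rw [hdeg, pow_add]; ring
    · have h1 : ¬ ∀ k, β (Sum.inr k) = (Finsupp.single p 1 : κ →₀ ℕ) k := by
        intro h1
        refine h fun k hk => ?_
        rw [h1, Finsupp.single_eq_of_ne hk]
      rw [if_neg h, if_neg h]
      simp only [a, if_neg h1]
      simpa using hnonneg
  let M : ℝ := ((ρ : ℝ) ^ 2)⁻¹ * ∑' β, ‖MvPowerSeries.coeff β c‖ * (ρ : ℝ) ^ β.degree
  have hmain : ∀ t : 𝕜, ‖t‖ ≤ ρ →
      ‖evalAt c (z t) - evalAt c (z 0) - t * evalAt (linearPart p c) x‖ ≤ M * ‖t‖ ^ 2 := by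
    intro t ht
    have hs1 := summable_evalAt hc (hz t ht)
    have hs0 := summable_evalAt hc (hz 0 (by simp))
    have h1 : evalAt c (z t) - evalAt c (z 0) - t * evalAt (linearPart p c) x =
        ∑' β, (MvPowerSeries.coeff β c * ∏ i, z t i ^ β i -
          MvPowerSeries.coeff β c * ∏ i, z 0 i ^ β i - t * a β) := by
      rw [(hs1.sub hs0).tsum_sub (ha_sum.mul_left t), hs1.tsum_sub hs0, tsum_mul_left, ha_tsum]
      rfl
    rw [h1]
    have h2 := (summable_norm_coeff_mul hc).mul_left (‖t‖ ^ 2 * ((ρ : ℝ) ^ 2)⁻¹)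
    refine (tsum_of_norm_bounded h2.hasSum (hbound t ht)).trans (le_of_eq ?_)
    rw [tsum_mul_left]
    simp only [M]
    ring
  rw [hasDerivAt_iff_isLittleO]
  have hO : (fun t : 𝕜 => evalAt c (z t) - evalAt c (z 0) - t * evalAt (linearPart p c) x)
      =O[𝓝 0] fun t => t ^ 2 := by
    refine Asymptotics.IsBigO.of_bound M ?_
    filter_upwards [Metric.closedBall_mem_nhds (0 : 𝕜) hρ'] with t ht
    rw [mem_closedBall_zero_iff] at ht
    rw [norm_pow]
    exact hmain t ht
  have hlo : (fun t : 𝕜 => t ^ 2) =o[𝓝 0] fun t => t := by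
    simpa using Asymptotics.isLittleO_pow_pow (𝕜 := 𝕜) (m := 1) (n := 2) (by norm_num)
  simpa [z] using hO.trans_isLittleO hlo

end linearPart

end

/-! ### Degree weights, derivatives and the perturbation estimate. -/

section

variable {𝕜 : Type*} [RCLike 𝕜]

section small

variable {σ : Type*}

theorem eventually_wnorm_ne_top {ρ : ℝ≥0} (hρ : ρ ≠ 0) {f : MvPowerSeries σ 𝕜}
    (hf : wnorm ρ f ≠ ⊤) : ∀ᶠ ρ' in 𝓝[>] (0 : ℝ≥0), wnorm ρ' f ≠ ⊤ := by
  filter_upwards [Ioc_mem_nhdsGT (pos_iff_ne_zero.2 hρ)] with ρ' h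
  exact ne_top_of_le_ne_top hf (wnorm_mono h.2 f)

theorem IsConvergent.eventually_wnorm_ne_top {n : ℕ} {f : MvPowerSeries (Fin n) 𝕜}
    (hf : IsConvergent f) : ∀ᶠ ρ in 𝓝[>] (0 : ℝ≥0), wnorm ρ f ≠ ⊤ := by
  obtain ⟨ρ, hρ, h⟩ := isConvergent_iff.1 hf
  exact BigDenominators.eventually_wnorm_ne_top hρ h

theorem eventually_wnorm_le {ρ : ℝ≥0} (hρ : ρ ≠ 0) {f : MvPowerSeries σ 𝕜}
    (hf : wnorm ρ f ≠ ⊤) (h0 : MvPowerSeries.constantCoeff f = 0) {ε : ℝ≥0} (hε : ε ≠ 0) :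
    ∀ᶠ ρ' in 𝓝[>] (0 : ℝ≥0), wnorm ρ' f ≤ ε := by
  lift wnorm ρ f to ℝ≥0 using hf with N hN
  have hpos : 0 < min ρ (ε * ρ / (N + 1)) := by
    refine lt_min (pos_iff_ne_zero.2 hρ) ?_
    have := pos_iff_ne_zero.2 hρ
    have := pos_iff_ne_zero.2 hε
    positivity
  filter_upwards [Ioc_mem_nhdsGT hpos] with ρ' h
  have h1 := wnorm_le_of_le_order (h.2.trans (min_le_left _ _)) hρ f (e := 1) fun α hα => by
    have : α = 0 := (Finsupp.degree_eq_zero_iff α).1 (by omega)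
    rw [this]
    exact h0
  refine h1.trans ?_
  rw [← hN, pow_one, ← ENNReal.coe_mul, ENNReal.coe_le_coe]
  have h2 : ρ' ≤ ε * ρ / (N + 1) := h.2.trans (min_le_right _ _)
  calc ρ' / ρ * N ≤ ε * ρ / (N + 1) / ρ * (N + 1) := by gcongr; exact le_self_add
    _ = ε := by field_simp

end small

section degMul

variable {σ : Type*}

/-- The series `∑ (|α| + 1) ^ l f_α x ^ α`. -/
def degMul (l : ℕ) (f : MvPowerSeries σ 𝕜) : MvPowerSeries σ 𝕜 :=
  fun γ => ((γ.degree + 1 : ℕ) : 𝕜) ^ l * MvPowerSeries.coeff γ f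

theorem coeff_degMul (l : ℕ) (f : MvPowerSeries σ 𝕜) (γ : σ →₀ ℕ) :
    MvPowerSeries.coeff γ (degMul l f) =
      ((γ.degree + 1 : ℕ) : 𝕜) ^ l * MvPowerSeries.coeff γ f := rfl

theorem degMul_add (l : ℕ) (f g : MvPowerSeries σ 𝕜) :
    degMul l (f + g) = degMul l f + degMul l g := by
  ext γ
  simp only [coeff_degMul, map_add, mul_add]

theorem enorm_natCast (k : ℕ) : ‖(k : 𝕜)‖ₑ = k := by
  simp [enorm_eq_nnnorm]

theorem enorm_coeff_degMul (l : ℕ) (f : MvPowerSeries σ 𝕜) (γ : σ →₀ ℕ) :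
    ‖MvPowerSeries.coeff γ (degMul l f)‖ₑ =
      ((γ.degree + 1 : ℕ) : ℝ≥0∞) ^ l * ‖MvPowerSeries.coeff γ f‖ₑ := by
  rw [coeff_degMul, enorm_mul, enorm_pow, enorm_natCast]

theorem wnorm_le_wnorm_degMul (l : ℕ) (ρ : ℝ≥0) (f : MvPowerSeries σ 𝕜) :
    wnorm ρ f ≤ wnorm ρ (degMul l f) := by
  refine wnorm_le_wnorm fun α => ?_
  rw [enorm_coeff_degMul]
  refine le_mul_of_one_le_left (zero_le) (one_le_pow₀ ?_)
  exact_mod_cast Nat.le_add_left 1 _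

theorem succ_pow_le_two_pow (k l : ℕ) : (k + 1) ^ l ≤ l.factorial * 2 ^ (k + l) := by
  calc (k + 1) ^ l ≤ (k + 1).ascFactorial l := Nat.pow_succ_le_ascFactorial _ _
    _ = l.factorial * (k + l).choose l := Nat.ascFactorial_eq_factorial_mul_choose _ _
    _ ≤ _ := by gcongr; exact Nat.choose_le_two_pow _ _

/-- Halving the radius absorbs a polynomial weight. This serves only to show that `degMul` preserves
convergence; the iteration itself cannot afford a loss of radius. -/
theorem wnorm_degMul_le (l : ℕ) (ρ : ℝ≥0) (f : MvPowerSeries σ 𝕜) :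
    wnorm (ρ / 2) (degMul l f) ≤ ((l.factorial * 2 ^ l : ℕ) : ℝ≥0∞) * wnorm ρ f := by
  unfold wnorm
  rw [← ENNReal.tsum_mul_left]
  refine ENNReal.tsum_le_tsum fun α => ?_
  rw [enorm_coeff_degMul]
  have h : ((α.degree + 1 : ℕ) : ℝ≥0∞) ^ l * ((ρ / 2 : ℝ≥0) : ℝ≥0∞) ^ α.degree ≤
      ((l.factorial * 2 ^ l : ℕ) : ℝ≥0∞) * (ρ : ℝ≥0∞) ^ α.degree := by
    have h1 : (((α.degree + 1) ^ l : ℕ) : ℝ≥0) ≤ ((l.factorial * 2 ^ (α.degree + l) : ℕ) : ℝ≥0) :=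
      Nat.cast_le.2 (succ_pow_le_two_pow _ _)
    have h2 : ((α.degree + 1 : ℕ) : ℝ≥0) ^ l * (ρ / 2) ^ α.degree ≤
        ((l.factorial * 2 ^ l : ℕ) : ℝ≥0) * ρ ^ α.degree := by
      calc _ ≤ ((l.factorial * 2 ^ (α.degree + l) : ℕ) : ℝ≥0) * (ρ / 2) ^ α.degree := by
            rw [← Nat.cast_pow]
            gcongr
        _ = _ := by
            push_cast
            rw [div_pow, pow_add]
            field_simp
    exact_mod_cast h2
  calc _ = ‖MvPowerSeries.coeff α f‖ₑ * (((α.degree + 1 : ℕ) : ℝ≥0∞) ^ l *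
        ((ρ / 2 : ℝ≥0) : ℝ≥0∞) ^ α.degree) := by ring
    _ ≤ ‖MvPowerSeries.coeff α f‖ₑ * (((l.factorial * 2 ^ l : ℕ) : ℝ≥0∞) *
        (ρ : ℝ≥0∞) ^ α.degree) := by gcongr
    _ = _ := by ring

theorem IsConvergent.degMul {n : ℕ} {f : MvPowerSeries (Fin n) 𝕜} (hf : IsConvergent f) (l : ℕ) :
    IsConvergent (degMul l f) := by
  obtain ⟨ρ, hρ, h⟩ := isConvergent_iff.1 hf
  exact isConvergent_iff.2 ⟨ρ / 2, div_ne_zero hρ two_ne_zero, ne_top_of_le_ne_top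
    (ENNReal.mul_ne_top (ENNReal.natCast_ne_top _) h) (wnorm_degMul_le l ρ f)⟩

end degMul

section partialDeriv

variable {n : ℕ}

theorem coeff_partialDeriv (α β : Fin n →₀ ℕ) (f : MvPowerSeries (Fin n) 𝕜) :
    MvPowerSeries.coeff β (partialDeriv α f) =
      (∏ i, (((β i + α i).descFactorial (α i) : ℕ) : 𝕜)) * MvPowerSeries.coeff (β + α) f := rfl

theorem partialDeriv_add (α : Fin n →₀ ℕ) (f g : MvPowerSeries (Fin n) 𝕜) :
    partialDeriv α (f + g) = partialDeriv α f + partialDeriv α g := by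
  ext β
  simp only [coeff_partialDeriv, map_add, mul_add]

theorem partialDeriv_zero (α : Fin n →₀ ℕ) :
    partialDeriv α (0 : MvPowerSeries (Fin n) 𝕜) = 0 := by
  ext β
  simp [coeff_partialDeriv]

theorem prod_descFactorial_le (α β : Fin n →₀ ℕ) {l : ℕ} (hα : α.degree ≤ l) :
    ∏ i, (β i + α i).descFactorial (α i) ≤ ((β + α).degree + 1) ^ l := by
  calc ∏ i, (β i + α i).descFactorial (α i) ≤ ∏ i, ((β + α).degree + 1) ^ α i := by
        refine Finset.prod_le_prod' fun i _ => (Nat.descFactorial_le_pow _ _).trans ?_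
        refine Nat.pow_le_pow_left ?_ _
        exact (Finsupp.le_degree i (β + α)).trans (Nat.le_succ _)
    _ = ((β + α).degree + 1) ^ α.degree := by
        rw [Finset.prod_pow_eq_pow_sum, Finsupp.degree_eq_sum α]
    _ ≤ _ := Nat.pow_le_pow_right (Nat.succ_pos _) hα

/-- The factorials produced by `∂^α` are dominated by the weight of `degMul l`, so a derivative
costs only the factor `ρ ^ (-|α|)` and no radius. -/
theorem wnorm_partialDeriv_mul_le (ρ : ℝ≥0) {α : Fin n →₀ ℕ} {l : ℕ} (hα : α.degree ≤ l)
    (f : MvPowerSeries (Fin n) 𝕜) :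
    wnorm ρ (partialDeriv α f) * (ρ : ℝ≥0∞) ^ α.degree ≤ wnorm ρ (degMul l f) := by
  unfold wnorm
  rw [← ENNReal.tsum_mul_right]
  refine le_trans (ENNReal.tsum_le_tsum fun β => ?_)
    (ENNReal.tsum_comp_le_tsum_of_injective (add_left_injective α) _)
  rw [enorm_coeff_degMul, coeff_partialDeriv, enorm_mul, map_add, pow_add, ← mul_assoc]
  gcongr
  rw [← Nat.cast_prod, enorm_natCast, ← Nat.cast_pow, ← map_add]
  exact_mod_cast prod_descFactorial_le α β hα

theorem IsConvergent.partialDeriv {f : MvPowerSeries (Fin n) 𝕜} (hf : IsConvergent f)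
    (α : Fin n →₀ ℕ) : IsConvergent (partialDeriv α f) := by
  obtain ⟨ρ, hρ, h⟩ := isConvergent_iff.1 (hf.degMul α.degree)
  refine isConvergent_iff.2 ⟨ρ, hρ, fun htop => h ?_⟩
  have h1 := wnorm_partialDeriv_mul_le ρ (le_refl α.degree) f
  rw [htop, ENNReal.top_mul (pow_ne_zero _ (ENNReal.coe_ne_zero.2 hρ))] at h1
  exact top_le_iff.1 h1

end partialDeriv

section perturbation

variable {ι κ : Type*} [Fintype ι] [Fintype κ]

/-- Insert a family of power series in the variables `x` for the second group of variables of a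
power series in `x, v`. -/
def graphSubst (g : κ → MvPowerSeries ι 𝕜) : ι ⊕ κ → MvPowerSeries ι 𝕜 :=
  Sum.elim MvPowerSeries.X g

theorem wnorm_graphSubst_le {ι κ : Type*} {g : κ → MvPowerSeries ι 𝕜} {ρ ρ₁ : ℝ≥0} (hρ : ρ ≤ ρ₁)
    (hg : ∀ p, wnorm ρ (g p) ≤ ρ₁) (i : ι ⊕ κ) : wnorm ρ (graphSubst g i) ≤ ρ₁ := by
  rcases i with i | p
  · simpa [graphSubst, wnorm_X] using hρ
  · exact hg p

/-- Here `ρ` bounds the `x` variables and `R * ρ ^ a k` bounds `v_k`. A monomial linear in `v`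
yields `ρ ^ (e + a p) ≤ ρ ^ E`, with `e` factors taken from `x`; one of higher degree in `v` yields
`(R * ρ ^ L) ^ 2`, and `E ≤ 2 * L`. All other factors are at most `ρ₁`, which leaves `ρ₁ ^ β.degree`
up to constants, ready to be summed against the coefficients at the fixed radius `ρ₁`. -/
theorem monomial_bound {β : ι ⊕ κ →₀ ℕ} {a : κ → ℕ} {ρ ρ₁ R : ℝ≥0} {L E : ℕ} (hρ : ρ ≤ ρ₁)
    (hρ₁0 : ρ₁ ≠ 0) (hρ₁ : ρ₁ ≤ 1) (hR : R * ρ ^ L ≤ ρ₁) (ha : ∀ p, L ≤ a p) (hE : E ≤ 2 * L)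
    (hlin : ∀ p, (∀ k, β (Sum.inr k) = (Finsupp.single p 1 : κ →₀ ℕ) k) →
      ∃ e, e ≤ ∑ i, β (Sum.inl i) ∧ e ≤ L ∧ E ≤ e + a p)
    (hβ : ∃ k, β (Sum.inr k) ≠ 0) :
    (ρ ^ ∑ i, β (Sum.inl i)) * ∏ k, (R * ρ ^ a k) ^ β (Sum.inr k) ≤
      (R * ρ₁⁻¹ ^ (L + 1) + R ^ 2 * ρ₁⁻¹ ^ 2) * ρ ^ E * ρ₁ ^ β.degree := by
  classical
  have hρ1 : ρ ≤ 1 := hρ.trans hρ₁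
  have hinv : 1 ≤ ρ₁⁻¹ := (one_le_inv₀ (pos_iff_ne_zero.2 hρ₁0)).2 hρ₁
  have hdeg : β.degree = ∑ i, β (Sum.inl i) + ∑ k, β (Sum.inr k) := by
    rw [Finsupp.degree_eq_sum, Fintype.sum_sum_type]
  rw [hdeg]
  set b := ∑ i, β (Sum.inl i)
  obtain ⟨p, hp⟩ := hβ
  by_cases hs : ∀ k, β (Sum.inr k) = (Finsupp.single p 1 : κ →₀ ℕ) k
  · obtain ⟨e, heb, heL, hEe⟩ := hlin p hs
    have h1 : ∏ k, (R * ρ ^ a k) ^ β (Sum.inr k) = R * ρ ^ a p := by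
      rw [Finset.prod_eq_single p]
      · simp [hs]
      · intro k _ hk
        simp [hs, Finsupp.single_eq_of_ne hk]
      · simp
    have h2 : ∑ k, β (Sum.inr k) = 1 := by
      simp only [hs]
      rw [← Finsupp.degree_eq_sum, Finsupp.degree_single]
    rw [h1, h2]
    obtain ⟨b', hb'⟩ := Nat.exists_eq_add_of_le heb
    have h3 : ρ₁ ^ b' ≤ ρ₁⁻¹ ^ (L + 1) * ρ₁ ^ (b + 1) := by
      calc ρ₁ ^ b' = ρ₁⁻¹ ^ (e + 1) * ρ₁ ^ (b + 1) := by
            rw [hb', inv_pow]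
            field_simp
            ring
        _ ≤ _ := by gcongr
    calc ρ ^ b * (R * ρ ^ a p) = R * ρ ^ (e + a p) * ρ ^ b' := by rw [hb']; ring
      _ ≤ R * ρ ^ E * ρ₁ ^ b' := by
          refine mul_le_mul' (mul_le_mul' le_rfl ?_) (pow_le_pow_left' hρ _)
          exact pow_le_pow_of_le_one zero_le hρ1 hEe
      _ ≤ R * ρ ^ E * (ρ₁⁻¹ ^ (L + 1) * ρ₁ ^ (b + 1)) := by gcongr
      _ = R * ρ₁⁻¹ ^ (L + 1) * ρ ^ E * ρ₁ ^ (b + 1) := by ring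
      _ ≤ _ := by gcongr; exact le_self_add
  · have h2 : 2 ≤ ∑ k, β (Sum.inr k) := by
      by_contra hlt
      have hle : ∀ k, k ≠ p → β (Sum.inr k) = 0 ∧ β (Sum.inr p) = 1 := by
        intro k hk
        have : ∑ k' ∈ ({k, p} : Finset κ), β (Sum.inr k') ≤ ∑ k', β (Sum.inr k') :=
          Finset.sum_le_sum_of_subset (Finset.subset_univ _)
        rw [Finset.sum_pair hk] at this
        omega
      have hle' : β (Sum.inr p) ≤ ∑ k', β (Sum.inr k') :=
        Finset.single_le_sum (f := fun k => β (Sum.inr k)) (fun _ _ => Nat.zero_le _)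
          (Finset.mem_univ p)
      refine hs fun k => ?_
      by_cases hk : k = p
      · subst hk
        rw [Finsupp.single_eq_same]
        omega
      · rw [(hle k hk).1, Finsupp.single_eq_of_ne hk]
    have h3 : ∏ k, (R * ρ ^ a k) ^ β (Sum.inr k) ≤ (R * ρ ^ L) ^ ∑ k, β (Sum.inr k) := by
      rw [← Finset.prod_pow_eq_pow_sum]
      refine Finset.prod_le_prod' fun k _ => pow_le_pow_left' (mul_le_mul' le_rfl ?_) _
      exact pow_le_pow_of_le_one zero_le hρ1 (ha k)
    obtain ⟨c, hc⟩ := Nat.exists_eq_add_of_le h2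
    rw [hc] at h3 ⊢
    have h4 : ρ₁ ^ c = ρ₁⁻¹ ^ 2 * ρ₁ ^ (2 + c) := by
      rw [pow_add, inv_pow]
      field_simp
    calc _ ≤ ρ₁ ^ b * ((R * ρ ^ L) ^ 2 * ρ₁ ^ c) := by
          rw [pow_add] at h3
          refine mul_le_mul' (by gcongr) (h3.trans ?_)
          gcongr
      _ = R ^ 2 * ρ₁⁻¹ ^ 2 * ρ ^ (2 * L) * ρ₁ ^ (b + (2 + c)) := by
          rw [h4, pow_add ρ₁ b]
          ring
      _ ≤ R ^ 2 * ρ₁⁻¹ ^ 2 * ρ ^ E * ρ₁ ^ (b + (2 + c)) := by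
          refine mul_le_mul' (mul_le_mul' le_rfl ?_) le_rfl
          exact pow_le_pow_of_le_one zero_le hρ1 hE
      _ ≤ _ := by gcongr; exact le_add_self

/-- A quantitative form of the statement that the increment `c (x, g) - c (x, 0)` is dominated by
its linear part, whose coefficients are small by assumption. -/
theorem wnorm_comp_graphSubst_sub_le [DecidableEq κ] {c : MvPowerSeries (ι ⊕ κ) 𝕜}
    {g : κ → MvPowerSeries ι 𝕜} {e a : κ → ℕ} {ρ ρ₁ R : ℝ≥0} {L E : ℕ} (hρ0 : ρ ≠ 0) (hρ : ρ ≤ ρ₁)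
    (hρ₁ : ρ₁ ≤ 1) (hR : R * ρ ^ L ≤ ρ₁) (hc : wnorm ρ₁ c ≠ ⊤)
    (hlin : ∀ p (α : ι →₀ ℕ), α.degree < e p → MvPowerSeries.coeff α (linearPart p c) = 0)
    (hg : ∀ p, wnorm ρ (g p) ≤ ((R * ρ ^ a p : ℝ≥0) : ℝ≥0∞))
    (ha : ∀ p, L ≤ a p) (he : ∀ p, e p ≤ L) (hEL : E ≤ 2 * L) (hE : ∀ p, E ≤ e p + a p) :
    wnorm ρ (comp c (graphSubst g) - comp c (graphSubst 0)) ≤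
      (((R * ρ₁⁻¹ ^ (L + 1) + R ^ 2 * ρ₁⁻¹ ^ 2) * ρ ^ E : ℝ≥0) : ℝ≥0∞) * wnorm ρ₁ c := by
  have hρ₁0 : ρ₁ ≠ 0 := fun h => hρ0 (le_antisymm (h ▸ hρ) zero_le)
  have hρ1 : ρ ≤ 1 := hρ.trans hρ₁
  have hg' : ∀ p, wnorm ρ (g p) ≤ ρ₁ := fun p => (hg p).trans (by
    rw [ENNReal.coe_le_coe]
    refine le_trans ?_ hR
    exact mul_le_mul' le_rfl (pow_le_pow_of_le_one zero_le hρ1 (ha p)))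
  have hs := ne_top_of_le_ne_top hc (tsum_wnorm_compTerm_le c (wnorm_graphSubst_le hρ hg'))
  have hs0 := ne_top_of_le_ne_top hc (tsum_wnorm_compTerm_le c
    (wnorm_graphSubst_le (g := 0) hρ fun p => by simp [wnorm_zero]))
  unfold comp
  rw [seriesSum_sub hρ0 hs hs0]
  refine (wnorm_seriesSum_le _ _).trans ?_
  unfold wnorm
  rw [← ENNReal.tsum_mul_left]
  refine ENNReal.tsum_le_tsum fun β => ?_
  change wnorm ρ _ ≤ _
  by_cases hβ : ∃ k, β (Sum.inr k) ≠ 0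
  · have h0 : compTerm c (graphSubst (0 : κ → MvPowerSeries ι 𝕜)) β = 0 := by
      obtain ⟨k, hk⟩ := hβ
      unfold compTerm
      rw [Finset.prod_eq_zero (Finset.mem_univ (Sum.inr k)) (by simp [graphSubst, hk]), mul_zero]
    rw [h0, sub_zero]
    by_cases hcβ : MvPowerSeries.coeff β c = 0
    · simp [compTerm, hcβ, wnorm_zero]
    -- For a monomial linear in `v_p`, `coeff β c` is a coefficient of `linearPart p c`; being
    -- nonzero, it has degree at least `e p` in `x`.
    have key := monomial_bound (β := β) (a := a) hρ hρ₁0 hρ₁ hR ha hEL (fun p hp => by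
      refine ⟨e p, ?_, he p, hE p⟩
      by_contra hlt
      refine hcβ ?_
      have h1 : β = Finsupp.sumElim (Finsupp.comapDomain Sum.inl β Sum.inl_injective.injOn)
          (Finsupp.single p 1) := by
        ext (i | k)
        · simp
        · simp [hp]
      rw [h1, ← coeff_linearPart]
      refine hlin p _ ?_
      rw [Finsupp.degree_eq_sum]
      simpa using hlt) hβ
    calc _ ≤ ‖MvPowerSeries.coeff β c‖ₑ * ∏ i, wnorm ρ (graphSubst g i) ^ β i :=
          wnorm_compTerm_le_prod _ _ _ _
      _ ≤ ‖MvPowerSeries.coeff β c‖ₑ * (((ρ ^ ∑ i, β (Sum.inl i)) *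
            ∏ k, (R * ρ ^ a k) ^ β (Sum.inr k) : ℝ≥0) : ℝ≥0∞) := by
          gcongr
          rw [Fintype.prod_sum_type, ENNReal.coe_mul, ← Finset.prod_pow_eq_pow_sum]
          push_cast
          refine mul_le_mul' (le_of_eq ?_) (Finset.prod_le_prod' fun k _ => pow_le_pow_left' ?_ _)
          · simp [graphSubst, wnorm_X]
          · simpa [graphSubst] using hg k
      _ ≤ ‖MvPowerSeries.coeff β c‖ₑ * (((R * ρ₁⁻¹ ^ (L + 1) + R ^ 2 * ρ₁⁻¹ ^ 2) * ρ ^ E *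
            ρ₁ ^ β.degree : ℝ≥0) : ℝ≥0∞) := by gcongr
      _ = _ := by
          rw [ENNReal.coe_mul _ (ρ₁ ^ _), ENNReal.coe_pow]
          ring
  -- Monomials in `x` alone do not see `g` and cancel.
  · push Not at hβ
    have h0 : compTerm c (graphSubst g) β = compTerm c (graphSubst 0) β := by
      unfold compTerm
      rw [Fintype.prod_sum_type, Fintype.prod_sum_type]
      simp [graphSubst, hβ]
    rw [h0, sub_self, wnorm_zero]
    exact zero_le

end perturbation

end

/-! ### Expansion of `W` around the jet of an analytic tuple. -/

section

variable {𝕜 : Type*} [RCLike 𝕜] {n r s : ℕ} {m : Fin r → ℕ}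

theorem jet_apply (F : Fin r → MvPowerSeries (Fin n) 𝕜) (x : Fin n → 𝕜) (p : JetIndex n m) :
    jet m F x p = evalAt (partialDeriv p.2.1 (F p.1)) x := rfl

theorem tendsto_jet {F : Fin r → MvPowerSeries (Fin n) 𝕜} (hF : F ∈ An 𝕜 n r) :
    Tendsto (jet m F) (𝓝 0) (𝓝 (jet m F 0)) := by
  rw [tendsto_pi_nhds]
  intro p
  obtain ⟨ρ, hρ, h⟩ := isConvergent_iff.1 ((hF p.1).partialDeriv p.2.1)
  exact tendsto_evalAt hρ h

theorem eventually_jet_add {F G : Fin r → MvPowerSeries (Fin n) 𝕜} (hF : F ∈ An 𝕜 n r)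
    (hG : G ∈ An 𝕜 n r) : ∀ᶠ x in 𝓝 (0 : Fin n → 𝕜), jet m (F + G) x = jet m F x + jet m G x := by
  have h : ∀ p : JetIndex n m, ∀ᶠ x in 𝓝 (0 : Fin n → 𝕜),
      jet m (F + G) x p = jet m F x p + jet m G x p := by
    intro p
    obtain ⟨ρ, hρ, hρ'⟩ := (((hF p.1).partialDeriv p.2.1).eventually_wnorm_ne_top.and
      (((hG p.1).partialDeriv p.2.1).eventually_wnorm_ne_top.and self_mem_nhdsWithin)).exists
    filter_upwards [eventually_norm_le (𝕜 := 𝕜) (σ := Fin n) (pos_iff_ne_zero.1 hρ'.2)] with x hx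
    rw [jet_apply, Pi.add_apply, partialDeriv_add, evalAt_add hρ hρ'.1 hx]
    rfl
  filter_upwards [eventually_all.2 h] with x hx
  exact funext hx

theorem jet_zero (x : Fin n → 𝕜) : jet m (0 : Fin r → MvPowerSeries (Fin n) 𝕜) x = 0 := by
  ext p
  rw [jet_apply, Pi.zero_apply, partialDeriv_zero]
  simp [evalAt]

/-- The expansion in convergent power series of a function on the jet space around the jet of an
analytic tuple. -/
theorem exists_expansion_along_jet {W : (Fin n → 𝕜) × (JetIndex n m → 𝕜) → Fin s → 𝕜}
    {F : Fin r → MvPowerSeries (Fin n) 𝕜} (hF : F ∈ An 𝕜 n r)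
    (hW : AnalyticAt 𝕜 W (0, jet m F 0)) (i : Fin s) :
    ∃ (c : MvPowerSeries (Fin n ⊕ JetIndex n m) 𝕜) (ρ : ℝ≥0), ρ ≠ 0 ∧ wnorm ρ c ≠ ⊤ ∧
      ∀ᶠ z in 𝓝 (0 : Fin n ⊕ JetIndex n m → 𝕜),
        W (fun k => z (Sum.inl k), jet m F (fun k => z (Sum.inl k)) + fun p => z (Sum.inr p)) i =
          evalAt c z := by
  let u₀ := jet m F 0
  have hg : AnalyticAt 𝕜 (fun z : Fin n ⊕ JetIndex n m → 𝕜 =>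
      W (fun k => z (Sum.inl k), u₀ + fun p => z (Sum.inr p)) i) 0 := by
    have h1 : AnalyticAt 𝕜 (fun z : Fin n ⊕ JetIndex n m → 𝕜 =>
        ((fun k => z (Sum.inl k), u₀ + fun p => z (Sum.inr p)) :
          (Fin n → 𝕜) × (JetIndex n m → 𝕜))) 0 := by
      refine AnalyticAt.prod ?_ (analyticAt_const.add ?_)
      · exact (ContinuousLinearMap.pi fun k => ContinuousLinearMap.proj (R := 𝕜)
          (φ := fun _ : Fin n ⊕ JetIndex n m => 𝕜) (Sum.inl k)).analyticAt 0
      · exact (ContinuousLinearMap.pi fun k => ContinuousLinearMap.proj (R := 𝕜)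
          (φ := fun _ : Fin n ⊕ JetIndex n m => 𝕜) (Sum.inr k)).analyticAt 0
    have h3 := AnalyticAt.comp_of_eq hW h1 (Prod.ext rfl (add_zero u₀))
    exact ((ContinuousLinearMap.proj (R := 𝕜) (φ := fun _ : Fin s => 𝕜) i).analyticAt _).comp h3
  obtain ⟨w, ρw, hρw, hw, hweq⟩ := exists_wnorm_ne_top_of_analyticAt hg
  let D : JetIndex n m → MvPowerSeries (Fin n) 𝕜 := fun p => partialDeriv p.2.1 (F p.1)
  -- The expansion `w` at `(0, u₀)` is recentred by substituting `u = u₀ + D' (x) + v`. Without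
  -- constant term, `D' p` is small at a small radius, so `D' p` and `v_p` can each take half of
  -- `ρw`.
  let D' : JetIndex n m → MvPowerSeries (Fin n) 𝕜 := fun p => D p - MvPowerSeries.C (u₀ p)
  have hDc : ∀ p, IsConvergent (D p) := fun p => (hF p.1).partialDeriv p.2.1
  have hD'0 : ∀ p, MvPowerSeries.constantCoeff (D' p) = 0 := by
    intro p
    simp only [D', map_sub, MvPowerSeries.constantCoeff_C, u₀, jet_apply, evalAt_zero_right]
    exact sub_self _
  have hCtop : ∀ (ρ : ℝ≥0) (a : 𝕜), wnorm ρ (MvPowerSeries.C a : MvPowerSeries (Fin n) 𝕜) ≠ ⊤ :=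
    fun ρ a => by rw [wnorm_C]; exact enorm_ne_top
  have hsmall : ∀ p, ∀ᶠ ρ in 𝓝[>] (0 : ℝ≥0), wnorm ρ (D' p) ≤ ((ρw / 2 : ℝ≥0) : ℝ≥0∞) := by
    intro p
    obtain ⟨ρ, hρ, h⟩ := isConvergent_iff.1 (hDc p)
    exact eventually_wnorm_le hρ (ne_top_of_le_ne_top (ENNReal.add_ne_top.2 ⟨h, hCtop ρ (u₀ p)⟩)
      (wnorm_sub_le ρ _ _)) (hD'0 p) (div_ne_zero hρw two_ne_zero)
  have hpos : 0 < ρw / 2 := pos_iff_ne_zero.2 (div_ne_zero hρw two_ne_zero)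
  obtain ⟨ρ, hρD, hρD', hρ⟩ := ((eventually_all.2 hsmall).and
    ((eventually_all.2 fun p => (hDc p).eventually_wnorm_ne_top).and
      (Ioc_mem_nhdsGT hpos))).exists
  have hρ0 : ρ ≠ 0 := pos_iff_ne_zero.1 hρ.1
  have hhalf : ((ρw / 2 : ℝ≥0) : ℝ≥0∞) + ((ρw / 2 : ℝ≥0) : ℝ≥0∞) = ρw := by
    rw [← ENNReal.coe_add, add_halves]
  have hhalf' : ρw / 2 ≤ ρw := half_le_self zero_le
  let X' : Fin n → MvPowerSeries (Fin n ⊕ JetIndex n m) 𝕜 := fun k => MvPowerSeries.X (Sum.inl k)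
  have hX' : ∀ k, wnorm ρ (X' k) ≤ ρ := fun k => le_of_eq (wnorm_X _ _)
  let h : Fin n ⊕ JetIndex n m → MvPowerSeries (Fin n ⊕ JetIndex n m) 𝕜 :=
    Sum.elim X' fun p => comp (D' p) X' + MvPowerSeries.X (Sum.inr p)
  have hcompD : ∀ p, wnorm ρ (comp (D' p) X') ≤ ((ρw / 2 : ℝ≥0) : ℝ≥0∞) := fun p =>
    (wnorm_comp_le (D' p) hX').trans (hρD p)
  have hh : ∀ k, wnorm ρ (h k) ≤ ρw := by
    rintro (k | p)
    · refine (hX' k).trans (ENNReal.coe_le_coe.2 (hρ.2.trans hhalf'))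
    · refine (wnorm_add_le _ _ _).trans ?_
      rw [← hhalf, wnorm_X]
      exact add_le_add (hcompD p) (ENNReal.coe_le_coe.2 hρ.2)
  refine ⟨comp w h, ρ, hρ0, ne_top_of_le_ne_top hw (wnorm_comp_le w hh), ?_⟩
  have hD'top : ∀ p, wnorm ρ (D' p) ≠ ⊤ := fun p =>
    ne_top_of_le_ne_top ENNReal.coe_ne_top (hρD p)
  have hinl : ∀ (z : Fin n ⊕ JetIndex n m → 𝕜) k, evalAt (h (Sum.inl k)) z = z (Sum.inl k) :=
    fun z k => evalAt_X _ _
  have hinr : ∀ z : Fin n ⊕ JetIndex n m → 𝕜, (∀ k, ‖z k‖ ≤ ρ) → ∀ p,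
      evalAt (h (Sum.inr p)) z = jet m F (fun k => z (Sum.inl k)) p - u₀ p + z (Sum.inr p) := by
    intro z hz p
    change evalAt (comp (D' p) X' + MvPowerSeries.X (Sum.inr p)) z = _
    rw [evalAt_add (ne_top_of_le_ne_top ENNReal.coe_ne_top (hcompD p))
      (by rw [wnorm_X]; exact ENNReal.coe_ne_top) hz, evalAt_X, evalAt_comp (hD'top p) hX' hz]
    congr 1
    simp only [X', evalAt_X, D']
    rw [evalAt_sub (hρD' p) (hCtop ρ _) fun k => hz (Sum.inl k), evalAt_C]
    rfl
  have hlim : Tendsto (fun z : Fin n ⊕ JetIndex n m → 𝕜 => fun k => evalAt (h k) z) (𝓝 0)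
      (𝓝 0) := by
    have h1 : Tendsto (fun z : Fin n ⊕ JetIndex n m → 𝕜 => fun k => evalAt (h k) z) (𝓝 0)
        (𝓝 fun k => evalAt (h k) 0) := by
      rw [tendsto_pi_nhds]
      exact fun k => tendsto_evalAt hρ0 (ne_top_of_le_ne_top ENNReal.coe_ne_top (hh k))
    convert h1 using 2
    ext (k | p)
    · rw [hinl]
    · rw [hinr _ (by simp)]
      simp only [Pi.zero_apply, add_zero, u₀]
      exact (sub_self _).symm
  filter_upwards [hlim.eventually hweq, eventually_norm_le (𝕜 := 𝕜) hρ0] with z hz1 hz2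
  rw [evalAt_comp hw hh hz2, ← hz1]
  have e1 : (fun k => evalAt (h (Sum.inl k)) z) = fun k => z (Sum.inl k) := funext (hinl z)
  have e2 : (u₀ + fun p => evalAt (h (Sum.inr p)) z) =
      jet m F (fun k => z (Sum.inl k)) + fun p => z (Sum.inr p) := by
    ext p
    simp only [Pi.add_apply]
    rw [hinr z hz2]
    ring
  rw [e1, e2]

/-- The linear part of the expansion of `W` around the jet of `F` is given by the partial
derivatives of `W` along the jet of `F`. -/
theorem linearPart_eq_of_isTaylorSeries {W : (Fin n → 𝕜) × (JetIndex n m → 𝕜) → Fin s → 𝕜}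
    {F : Fin r → MvPowerSeries (Fin n) 𝕜} (hF : F ∈ An 𝕜 n r)
    (hW : AnalyticAt 𝕜 W (0, jet m F 0)) (i : Fin s)
    {c : MvPowerSeries (Fin n ⊕ JetIndex n m) 𝕜} {ρ : ℝ≥0} (hρ : ρ ≠ 0) (hc : wnorm ρ c ≠ ⊤)
    (hWc : ∀ᶠ z in 𝓝 (0 : Fin n ⊕ JetIndex n m → 𝕜),
        W (fun k => z (Sum.inl k), jet m F (fun k => z (Sum.inl k)) + fun p => z (Sum.inr p)) i =
          evalAt c z) (p : JetIndex n m) {f : MvPowerSeries (Fin n) 𝕜}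
    (hf : IsTaylorSeries f fun x => jetPartial W i p (x, jet m F x)) :
    linearPart p c = f := by
  classical
  have hcont : Tendsto (fun x : Fin n → 𝕜 => (x, jet m F x)) (𝓝 0) (𝓝 (0, jet m F 0)) :=
    tendsto_id.prodMk_nhds (tendsto_jet hF)
  have hdiff := hcont.eventually hW.eventually_analyticAt
  have hemb : Tendsto (fun x : Fin n → 𝕜 => (Sum.elim x 0 : Fin n ⊕ JetIndex n m → 𝕜))
      (𝓝 0) (𝓝 0) := by
    refine Continuous.tendsto' ?_ _ _ ?_
    · refine continuous_pi ?_
      rintro (k | k)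
      · exact continuous_apply k
      · exact continuous_const
    · ext (k | k) <;> rfl
  -- The identity is needed on a neighbourhood of each `(x, 0)`, since it is differentiated in the
  -- direction `v_p`.
  have hloc := hemb.eventually hWc.eventually_nhds
  have hmain : ∀ᶠ x in 𝓝 (0 : Fin n → 𝕜), evalAt (linearPart p c) x = evalAt f x := by
    filter_upwards [hdiff, hloc, hf.2, eventually_norm_le (𝕜 := 𝕜) hρ] with x hx1 hx2 hx3 hx4
    have hd := hasDerivAt_evalAt_sumElim hρ p hc hx4
    have hline : Tendsto (fun t : 𝕜 => (Sum.elim x (Pi.single p t) : Fin n ⊕ JetIndex n m → 𝕜))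
        (𝓝 0) (𝓝 (Sum.elim x 0)) := by
      refine Continuous.tendsto' ?_ _ _ (by simp)
      refine continuous_pi ?_
      rintro (k | k)
      · exact continuous_const
      · exact (continuous_apply k).comp (continuous_single (A := fun _ => 𝕜) p)
    have hd' : HasDerivAt (fun t : 𝕜 => W (x, jet m F x + Pi.single p t) i)
        (evalAt (linearPart p c) x) 0 := by
      refine hd.congr_of_eventuallyEq ?_
      filter_upwards [hline.eventually hx2] with t ht
      exact ht
    have hs : HasDerivAt (fun t : 𝕜 => ((x, jet m F x + Pi.single p t) :
        (Fin n → 𝕜) × (JetIndex n m → 𝕜))) (0, Pi.single p 1) 0 := by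
      refine (hasDerivAt_const _ _).prodMk ?_
      refine HasDerivAt.const_add _ ?_
      rw [hasDerivAt_pi]
      intro k
      by_cases hk : k = p
      · subst hk
        simpa using hasDerivAt_id' (0 : 𝕜)
      · simpa [hk] using hasDerivAt_const (0 : 𝕜) (0 : 𝕜)
    have hWd : HasFDerivAt W (fderiv 𝕜 W (x, jet m F x)) (x, jet m F x + Pi.single p (0 : 𝕜)) := by
      rw [Pi.single_zero, add_zero]
      exact hx1.differentiableAt.hasFDerivAt
    have hcomp := hasDerivAt_pi.1 (hWd.comp_hasDerivAt (0 : 𝕜) hs) i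
    rw [hd'.unique hcomp]
    exact hx3
  obtain ⟨ρ', h1, h2, h3⟩ := (hf.1.eventually_wnorm_ne_top.and
    ((eventually_wnorm_ne_top hρ (wnorm_linearPart_ne_top hρ p hc)).and
      self_mem_nhdsWithin)).exists
  exact eq_of_eventually_evalAt_eq (pos_iff_ne_zero.1 h3) h2 h1 hmain

/-- The Taylor series of `x ↦ W (x, j_x (F + H))` as a composition of power series. -/
theorem eq_comp_graphSubst {W : (Fin n → 𝕜) × (JetIndex n m → 𝕜) → Fin s → 𝕜}
    {F H : Fin r → MvPowerSeries (Fin n) 𝕜} (hF : F ∈ An 𝕜 n r) (hH : H ∈ An 𝕜 n r) (i : Fin s)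
    {c : MvPowerSeries (Fin n ⊕ JetIndex n m) 𝕜} {ρ ρ₁ : ℝ≥0} (hρ0 : ρ ≠ 0) (hρ : ρ ≤ ρ₁)
    (hc : wnorm ρ₁ c ≠ ⊤)
    (hWc : ∀ᶠ z in 𝓝 (0 : Fin n ⊕ JetIndex n m → 𝕜),
        W (fun k => z (Sum.inl k), jet m F (fun k => z (Sum.inl k)) + fun p => z (Sum.inr p)) i =
          evalAt c z)
    (hH0 : jet m H 0 = 0)
    (hHρ : ∀ p : JetIndex n m, wnorm ρ (partialDeriv p.2.1 (H p.1)) ≤ ρ₁)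
    {f : MvPowerSeries (Fin n) 𝕜} (hf : IsTaylorSeries f fun x => W (x, jet m (F + H) x) i) :
    f = comp c (graphSubst fun p : JetIndex n m => partialDeriv p.2.1 (H p.1)) := by
  have hg := wnorm_graphSubst_le hρ hHρ
  have hcomp := ne_top_of_le_ne_top hc (wnorm_comp_le c hg)
  obtain ⟨ρ', h1, h2⟩ := (hf.1.eventually_wnorm_ne_top.and
    (Ioc_mem_nhdsGT (pos_iff_ne_zero.2 hρ0))).exists
  refine eq_of_eventually_evalAt_eq (pos_iff_ne_zero.1 h2.1) h1
    (ne_top_of_le_ne_top hcomp (wnorm_mono h2.2 _)) ?_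
  have hlim : Tendsto (fun x : Fin n → 𝕜 =>
      (Sum.elim x (jet m H x) : Fin n ⊕ JetIndex n m → 𝕜)) (𝓝 0) (𝓝 0) := by
    rw [tendsto_pi_nhds]
    rintro (k | p)
    · exact (continuous_apply k).tendsto' _ _ rfl
    · have := (tendsto_pi_nhds.1 (tendsto_jet (m := m) hH)) p
      rwa [hH0] at this
  filter_upwards [hf.2, hlim.eventually hWc, eventually_jet_add hF hH,
    eventually_norm_le (𝕜 := 𝕜) hρ0] with x hx1 hx2 hx3 hx4
  rw [evalAt_comp hc hg hx4]
  have e : (fun k => evalAt (graphSubst (fun p : JetIndex n m => partialDeriv p.2.1 (H p.1)) k) x)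
      = Sum.elim x (jet m H x) := by
    ext (k | p)
    · exact evalAt_X _ _
    · rfl
  rw [e, ← hx2]
  refine hx1.symm.trans ?_
  rw [hx3]
  rfl

end

/-! ### Orders and the big denominators estimate. -/

section

variable {𝕜 : Type*} [RCLike 𝕜] {n r s : ℕ}

/-- All coefficients of degree less than `m j + L` in the component `j` vanish. -/
def VanishesBelow {k : ℕ} (m : Fin k → ℕ) (L : ℤ) (F : Fin k → MvPowerSeries (Fin n) 𝕜) : Prop :=
  ∀ j (α : Fin n →₀ ℕ), (α.degree : ℤ) < m j + L → MvPowerSeries.coeff α (F j) = 0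

theorem VanishesBelow.mono {k : ℕ} {m : Fin k → ℕ} {L L' : ℤ}
    {F : Fin k → MvPowerSeries (Fin n) 𝕜} (h : VanishesBelow m L F) (hL : L' ≤ L) :
    VanishesBelow m L' F := fun j α hα => h j α (by omega)

theorem VanishesBelow.add {k : ℕ} {m : Fin k → ℕ} {L : ℤ}
    {F G : Fin k → MvPowerSeries (Fin n) 𝕜} (hF : VanishesBelow m L F) (hG : VanishesBelow m L G) :
    VanishesBelow m L (F + G) := fun j α hα => by
  rw [Pi.add_apply, map_add, hF j α hα, hG j α hα, add_zero]

theorem le_ord_iff {k : ℕ} {m : Fin k → ℕ} {L : ℤ} {F : Fin k → MvPowerSeries (Fin n) 𝕜} :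
    (L : WithTop ℤ) ≤ ord m F ↔ VanishesBelow m L F := by
  unfold ord VanishesBelow
  rw [Finset.le_inf_iff]
  simp only [Finset.mem_univ, true_imp_iff]
  refine forall_congr' fun j => ?_
  constructor
  · intro h α hα
    refine MvPowerSeries.coeff_of_lt_order ?_
    by_contra hlt
    rw [not_lt] at hlt
    obtain ⟨k, hk⟩ := ENat.ne_top_iff_exists.1 (ne_top_of_le_ne_top (ENat.natCast_ne_top _) hlt)
    rw [← hk] at h hlt
    have h1 : (L : WithTop ℤ) ≤ (((k : ℤ) - m j : ℤ) : WithTop ℤ) := h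
    rw [WithTop.coe_le_coe] at h1
    have h2 : k ≤ α.degree := by exact_mod_cast hlt
    omega
  · intro h
    by_cases htop : (F j).order = ⊤
    · rw [htop]
      exact le_top
    · obtain ⟨k, hk⟩ := ENat.ne_top_iff_exists.1 htop
      rw [← hk]
      change (L : WithTop ℤ) ≤ (((k : ℤ) - m j : ℤ) : WithTop ℤ)
      rw [WithTop.coe_le_coe]
      by_contra hlt
      obtain ⟨α, hα, hdeg⟩ := MvPowerSeries.exists_coeff_ne_zero_and_order
        (show ((F j).order.toNat : ℕ∞) = (F j).order by
          rw [← hk]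
          rfl)
      refine hα (h α ?_)
      rw [← hk] at hdeg
      have : α.degree = k := by exact_mod_cast hdeg
      omega

/-- For integer orders, a strict increase gains at least one: the `+ 1` that makes `Φ` contracting.
-/
theorem StrictlyIncreasesOrder.vanishesBelow_sub {m : Fin r → ℕ} {d e : ℤ}
    {T : Filt 𝕜 n m d → An 𝕜 n s} (hT : StrictlyIncreasesOrder T e) {F G : Filt 𝕜 n m d} {L : ℤ}
    (h : VanishesBelow m L (F.1 - G.1)) :
    VanishesBelow (fun _ => 0) (L + e + 1) ((T F).1 - (T G).1) := by
  by_cases hFG : F = G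
  · subst hFG
    intro j α _
    simp
  · have h1 := hT F G hFG
    have h2 : ((L + e : ℤ) : WithTop ℤ) ≤ ord m (F.1 - G.1) + (e : WithTop ℤ) := by
      rw [WithTop.coe_add]
      gcongr
      exact le_ord_iff.2 h
    have h3 := h2.trans_lt h1
    rw [← le_ord_iff]
    generalize ord (fun _ => 0) ((T F).1 - (T G).1) = o at h3 ⊢
    induction o using WithTop.recTopCoe with
    | top => exact le_top
    | coe a =>
      rw [WithTop.coe_lt_coe] at h3
      rw [WithTop.coe_le_coe]
      omega

theorem mem_finsuppAntidiag_univ {k : ℕ} {α : Fin n →₀ ℕ} :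
    α ∈ (Finset.univ : Finset (Fin n)).finsuppAntidiag k ↔ α.degree = k := by
  simp [Finset.mem_finsuppAntidiag, Finsupp.degree_eq_sum]

theorem tsum_eq_tsum_sum_degree (a : (Fin n →₀ ℕ) → ℝ≥0∞) :
    ∑' α, a α = ∑' k : ℕ, ∑ α ∈ (Finset.univ : Finset (Fin n)).finsuppAntidiag k, a α := by
  rw [← (Equiv.sigmaFiberEquiv (fun α : Fin n →₀ ℕ => α.degree)).tsum_eq, ENNReal.tsum_sigma']
  refine tsum_congr fun k => ?_
  rw [← Finset.tsum_subtype]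
  exact (Equiv.subtypeEquivRight fun α => mem_finsuppAntidiag_univ.symm :
    {α : Fin n →₀ ℕ // α.degree = k} ≃
      {α // α ∈ (Finset.univ : Finset (Fin n)).finsuppAntidiag k}).tsum_eq
    fun α => a α.1

/-- The sum of the norms of the coefficients of degree `k`. -/
def degNorm (k : ℕ) (f : MvPowerSeries (Fin n) 𝕜) : ℝ≥0∞ :=
  ∑ α ∈ (Finset.univ : Finset (Fin n)).finsuppAntidiag k, ‖MvPowerSeries.coeff α f‖ₑ

theorem wnorm_eq_tsum_degNorm (ρ : ℝ≥0) (f : MvPowerSeries (Fin n) 𝕜) :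
    wnorm ρ f = ∑' k, degNorm k f * (ρ : ℝ≥0∞) ^ k := by
  unfold wnorm degNorm
  rw [tsum_eq_tsum_sum_degree]
  refine tsum_congr fun k => ?_
  rw [Finset.sum_mul]
  refine Finset.sum_congr rfl fun α hα => ?_
  rw [mem_finsuppAntidiag_univ.1 hα]

theorem degNorm_degMul (l k : ℕ) (f : MvPowerSeries (Fin n) 𝕜) :
    degNorm k (degMul l f) = ((k + 1 : ℕ) : ℝ≥0∞) ^ l * degNorm k f := by
  unfold degNorm
  rw [Finset.mul_sum]
  refine Finset.sum_congr rfl fun α hα => ?_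
  rw [enorm_coeff_degMul, mem_finsuppAntidiag_univ.1 hα]

theorem ofReal_homNorm_one (k : ℕ) (f : MvPowerSeries (Fin n) 𝕜) :
    ENNReal.ofReal (homNorm k fun _ : Fin 1 => f) = degNorm k f := by
  unfold homNorm degNorm
  rw [ciSup_const, ENNReal.ofReal_sum_of_nonneg fun _ _ => norm_nonneg _]
  simp only [ofReal_norm]

theorem ofReal_homNorm_le (k : ℕ) (G : Fin s → MvPowerSeries (Fin n) 𝕜) :
    ENNReal.ofReal (homNorm k G) ≤ ∑ i, degNorm k (G i) := by
  have h : homNorm k G ≤ ∑ i, ∑ α ∈ (Finset.univ : Finset (Fin n)).finsuppAntidiag k,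
      ‖MvPowerSeries.coeff α (G i)‖ := by
    refine Real.iSup_le (fun j => ?_) (Finset.sum_nonneg fun _ _ =>
      Finset.sum_nonneg fun _ _ => norm_nonneg _)
    exact Finset.single_le_sum (f := fun i =>
      ∑ α ∈ (Finset.univ : Finset (Fin n)).finsuppAntidiag k, ‖MvPowerSeries.coeff α (G i)‖)
      (fun _ _ => Finset.sum_nonneg fun _ _ => norm_nonneg _) (Finset.mem_univ j)
  refine (ENNReal.ofReal_le_ofReal h).trans (le_of_eq ?_)
  rw [ENNReal.ofReal_sum_of_nonneg fun _ _ => Finset.sum_nonneg fun _ _ => norm_nonneg _]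
  refine Finset.sum_congr rfl fun i _ => ?_
  rw [ENNReal.ofReal_sum_of_nonneg fun _ _ => norm_nonneg _]
  simp only [ofReal_norm]
  rfl

/-- Multiplication by `z ^ e` moves degree `k` to `k + e = t + l`; differentiating `l` times brings
it to `t` with the factor `(t + l) ⋯ (t + 1)`. -/
theorem coeff_derivShift (l : ℕ) (e : ℤ) (f : PowerSeries ℝ) {k t : ℕ} (h : (t : ℤ) + l = k + e) :
    (derivShift l e f).coeff t = ((t + l).descFactorial l : ℝ) * PowerSeries.coeff k f := by
  unfold derivShift
  rw [LaurentSeries.derivative_iterate_coeff, h, HahnSeries.coeff_single_mul_add, one_mul,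
    HahnSeries.ofPowerSeries_apply_coeff, ← h, ← Nat.cast_add,
    Polynomial.descPochhammer_smeval_eq_descFactorial]
  simp

/-- The majorant estimate for a "big denominators" inverse, degree by degree. -/
theorem descFactorial_mul_degNorm_le {C : ℝ} (hC : 0 < C) {l : ℕ} {e : ℤ}
    {f : MvPowerSeries (Fin n) 𝕜} {G : Fin s → MvPowerSeries (Fin n) 𝕜}
    (h : Dominates (C • HahnSeries.ofPowerSeries ℤ ℝ (hat G))
      (derivShift l e (hat fun _ : Fin 1 => f))) {k t : ℕ} (hkt : (t : ℤ) + l = k + e) :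
    ((t + l).descFactorial l : ℝ≥0∞) * degNorm k f ≤
      ENNReal.ofReal C * ∑ i, degNorm t (G i) := by
  have h1 := (h t).2
  rw [coeff_derivShift l e _ hkt, HahnSeries.coeff_smul, HahnSeries.ofPowerSeries_apply_coeff,
    smul_eq_mul] at h1
  simp only [hat, PowerSeries.coeff_mk] at h1
  have h2 := ENNReal.ofReal_le_ofReal ((le_abs_self _).trans h1)
  rw [ENNReal.ofReal_mul (Nat.cast_nonneg _), ENNReal.ofReal_mul hC.le, ofReal_homNorm_one,
    ENNReal.ofReal_natCast] at h2
  exact h2.trans (by gcongr; exact ofReal_homNorm_le _ _)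

/-- The degree `k' + D` of `f` is controlled by the degree `k' + q` of `G`, with denominator `(k' +
q + l) ⋯ (k' + q + 1)`. It dominates the weight `(k' + D + 1) ^ l` up to the factor `(D + 1) ^ l`,
uniformly in `k'`. The power `ρ ^ q` stays on the left because `D - q` may be negative. -/
theorem pow_mul_wnorm_degMul_le {C : ℝ} (hC : 0 < C) {l q D : ℕ} {d : ℤ} (hD : (l : ℤ) + d = D)
    {f : MvPowerSeries (Fin n) 𝕜} {G : Fin s → MvPowerSeries (Fin n) 𝕜}
    (h : Dominates (C • HahnSeries.ofPowerSeries ℤ ℝ (hat G))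
      (derivShift l ((q : ℤ) - d) (hat fun _ : Fin 1 => f)))
    (hf : ∀ α : Fin n →₀ ℕ, α.degree < D → MvPowerSeries.coeff α f = 0) (ρ : ℝ≥0) :
    (ρ : ℝ≥0∞) ^ q * wnorm ρ (degMul l f) ≤
      (((D + 1) ^ l : ℕ) : ℝ≥0∞) * ENNReal.ofReal C * (ρ : ℝ≥0∞) ^ D * ∑ i, wnorm ρ (G i) := by
  have hsum : ∑ i, wnorm ρ (G i) = ∑' t, (∑ i, degNorm t (G i)) * (ρ : ℝ≥0∞) ^ t := by
    simp_rw [wnorm_eq_tsum_degNorm, Finset.sum_mul]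
    exact (Summable.tsum_finsetSum fun _ _ => ENNReal.summable).symm
  have hzero : ∀ k, k < D → degNorm k f = 0 := by
    intro k hk
    refine Finset.sum_eq_zero fun α hα => ?_
    rw [hf α (by rw [mem_finsuppAntidiag_univ.1 hα]; exact hk), enorm_zero]
  have hsupp : Function.support (fun k => degNorm k (degMul l f) * (ρ : ℝ≥0∞) ^ k) ⊆
      Set.range fun k' => k' + D := by
    intro k hk
    refine ⟨k - D, Nat.sub_add_cancel ?_⟩
    by_contra hlt
    exact hk (by simp [degNorm_degMul, hzero k (not_le.1 hlt)])
  rw [wnorm_eq_tsum_degNorm, hsum, ← (add_left_injective D).tsum_eq hsupp, ← ENNReal.tsum_mul_left,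
    ← ENNReal.tsum_mul_left]
  refine le_trans (ENNReal.tsum_le_tsum fun k' => ?_)
    (ENNReal.tsum_comp_le_tsum_of_injective (add_left_injective q) _)
  have h1 := descFactorial_mul_degNorm_le hC h (k := k' + D) (t := k' + q) (by push_cast; omega)
  have h2 : (((k' + D + 1 : ℕ) : ℝ≥0∞)) ^ l ≤
      (((D + 1) ^ l : ℕ) : ℝ≥0∞) * ((k' + q + l).descFactorial l : ℝ≥0∞) := by
    have h3 : (k' + D + 1) ^ l ≤ (D + 1) ^ l * (k' + q + l).descFactorial l := by
      calc (k' + D + 1) ^ l ≤ ((D + 1) * (k' + q + 1)) ^ l := by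
            refine Nat.pow_le_pow_left ?_ _
            nlinarith [Nat.zero_le (D * k'), Nat.zero_le (D * q)]
        _ = (D + 1) ^ l * (k' + q + 1) ^ l := mul_pow _ _ _
        _ ≤ _ := by
            rw [Nat.add_descFactorial_eq_ascFactorial]
            gcongr
            exact Nat.pow_succ_le_ascFactorial _ _
    exact_mod_cast h3
  rw [degNorm_degMul]
  calc (ρ : ℝ≥0∞) ^ q * (((k' + D + 1 : ℕ) : ℝ≥0∞) ^ l * degNorm (k' + D) f *
        (ρ : ℝ≥0∞) ^ (k' + D))
      ≤ (ρ : ℝ≥0∞) ^ q * ((((D + 1) ^ l : ℕ) : ℝ≥0∞) * ((k' + q + l).descFactorial l : ℝ≥0∞) *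
        degNorm (k' + D) f * (ρ : ℝ≥0∞) ^ (k' + D)) := by gcongr
    _ = (((D + 1) ^ l : ℕ) : ℝ≥0∞) * (((k' + q + l).descFactorial l : ℝ≥0∞) *
        degNorm (k' + D) f) * (ρ : ℝ≥0∞) ^ D * (ρ : ℝ≥0∞) ^ (k' + q) := by ring
    _ ≤ (((D + 1) ^ l : ℕ) : ℝ≥0∞) * (ENNReal.ofReal C * ∑ i, degNorm (k' + q) (G i)) *
        (ρ : ℝ≥0∞) ^ D * (ρ : ℝ≥0∞) ^ (k' + q) := by gcongr
    _ = _ := by ring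

/-- Orders under a "big denominators" inverse. -/
theorem vanishesBelow_of_dominates {C : ℝ} (hC : 0 < C) {q : ℕ} {d : ℤ} {m : Fin r → ℕ}
    {F : Fin r → MvPowerSeries (Fin n) 𝕜} (hF : VanishesBelow m (d + 1) F)
    (hd : ∀ j, -(m j : ℤ) ≤ d) {G : Fin s → MvPowerSeries (Fin n) 𝕜}
    (h : ∀ j, Dominates (C • HahnSeries.ofPowerSeries ℤ ℝ (hat G))
      (derivShift (m j) ((q : ℤ) - d) (hat fun _ : Fin 1 => F j))) {L : ℤ}
    (hG : VanishesBelow (fun _ => 0) L G) : VanishesBelow m (L + d - q) F := by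
  intro j α hα
  by_cases hlow : (α.degree : ℤ) < m j + (d + 1)
  · exact hF j α hlow
  · have hdj := hd j
    -- Beyond the `(m j + d)`-jet the target degree `t` is nonnegative, so the derivative does not
    -- kill the term and its factor is nonzero.
    obtain ⟨t, ht⟩ := Int.eq_ofNat_of_zero_le (a := (α.degree : ℤ) + (q - d) - m j) (by omega)
    have h1 := descFactorial_mul_degNorm_le hC (h j) (k := α.degree) (t := t) (by omega)
    have h2 : ∑ i, degNorm t (G i) = 0 := by
      refine Finset.sum_eq_zero fun i _ => Finset.sum_eq_zero fun β hβ => ?_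
      rw [hG i β, enorm_zero]
      rw [mem_finsuppAntidiag_univ.1 hβ]
      push_cast
      omega
    rw [h2, mul_zero, nonpos_iff_eq_zero, mul_eq_zero] at h1
    rcases h1 with h1 | h1
    · have h3 : (t + m j).descFactorial (m j) = 0 := by exact_mod_cast h1
      rw [Nat.descFactorial_eq_zero_iff_lt] at h3
      omega
    · have h3 := (Finset.sum_eq_zero_iff.1 h1) α (mem_finsuppAntidiag_univ.2 rfl)
      simpa using h3

end

/-! ### Analytic fixed points and the increment of `T`. -/

section

variable {𝕜 : Type*} [RCLike 𝕜] {n r s : ℕ} {m : Fin r → ℕ}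

theorem Filt.vanishesBelow {d : ℤ} (F : Filt 𝕜 n m d) : VanishesBelow m (d + 1) F.1 :=
  fun j α hα => F.2.2 j α (by omega)

theorem vanishesBelow_iterate_sub {d : ℤ} {Φ : Filt 𝕜 n m d → Filt 𝕜 n m d}
    (hΦ : ∀ (F G : Filt 𝕜 n m d) (L : ℤ), d + 1 ≤ L → VanishesBelow m L (F.1 - G.1) →
      VanishesBelow m (L + 1) ((Φ F).1 - (Φ G).1)) (k : ℕ) :
    VanishesBelow m (d + 1 + k) ((Φ^[k + 1] 0).1 - (Φ^[k] 0).1) := by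
  induction k with
  | zero =>
    have := Filt.vanishesBelow (Φ^[0 + 1] 0 - Φ^[0] 0)
    simpa using this
  | succ k ih =>
    have := hΦ _ _ _ (by omega) ih
    rw [← Function.iterate_succ_apply' Φ (k + 1), ← Function.iterate_succ_apply' Φ k] at this
    convert this using 1
    push_cast
    ring

/-- If a map is contracting with respect to the order and its iterates are bounded in a weighted
norm, then it has an analytic fixed point. -/
theorem exists_fixedPoint {d : ℤ} (hd : ∀ j, -(m j : ℤ) ≤ d) {Φ : Filt 𝕜 n m d → Filt 𝕜 n m d}
    (hΦ : ∀ (F G : Filt 𝕜 n m d) (L : ℤ), d + 1 ≤ L → VanishesBelow m L (F.1 - G.1) →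
      VanishesBelow m (L + 1) ((Φ F).1 - (Φ G).1))
    {ρ : ℝ≥0} (hρ : ρ ≠ 0) {R : ℝ≥0∞} (hR : R ≠ ⊤) {K : ℕ}
    (hbd : ∀ k, K ≤ k → ∀ j, wnorm ρ ((Φ^[k] 0).1 j) ≤ R) :
    ∃ F, Φ F = F := by
  have hstep := vanishesBelow_iterate_sub hΦ
  have hstab : ∀ j (α : Fin n →₀ ℕ) (k l : ℕ), (α.degree : ℤ) < m j + (d + 1 + k) →
      MvPowerSeries.coeff α ((Φ^[k + l] 0).1 j) = MvPowerSeries.coeff α ((Φ^[k] 0).1 j) := by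
    intro j α k l hk
    induction l with
    | zero => rfl
    | succ l ih =>
      rw [← ih, ← sub_eq_zero, ← map_sub]
      exact hstep (k + l) j α (by push_cast; omega)
  -- Since `m j + d ≥ 0`, a coefficient of degree `k` no longer changes from the `k`-th iterate on.
  let f : Fin r → MvPowerSeries (Fin n) 𝕜 := fun j α =>
    MvPowerSeries.coeff α ((Φ^[α.degree] 0).1 j)
  have hf : ∀ j (α : Fin n →₀ ℕ) (k : ℕ), (α.degree : ℤ) < m j + (d + 1 + k) →
      MvPowerSeries.coeff α (f j) = MvPowerSeries.coeff α ((Φ^[k] 0).1 j) := by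
    intro j α k hk
    change MvPowerSeries.coeff α ((Φ^[α.degree] 0).1 j) = _
    have hdj := hd j
    rw [← hstab j α α.degree k (by omega), ← hstab j α k α.degree hk, add_comm]
  have hfR : ∀ j, wnorm ρ (f j) ≤ R := by
    intro j
    unfold wnorm
    rw [ENNReal.tsum_eq_iSup_sum]
    refine iSup_le fun t => ?_
    -- A Fatou argument: the finitely many coefficients in a partial sum are all those of a single
    -- iterate beyond `K`.
    let k := K + t.sup fun α => α.degree
    refine le_trans (le_trans (le_of_eq (Finset.sum_congr rfl fun α hα => ?_))
      (ENNReal.sum_le_tsum t)) (hbd k (Nat.le_add_right _ _) j)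
    have h1 : α.degree ≤ t.sup fun α => α.degree := Finset.le_sup (f := fun α => α.degree) hα
    have hdj := hd j
    rw [hf j α k (by simp only [k]; push_cast; omega)]
  have hmem : f ∈ Filt 𝕜 n m d := by
    refine ⟨fun j => isConvergent_iff.2 ⟨ρ, hρ, ne_top_of_le_ne_top hR (hfR j)⟩, ?_⟩
    intro j α hα
    rw [hf j α 0 (by push_cast; omega)]
    exact (Φ^[0] 0).2.2 j α hα
  refine ⟨⟨f, hmem⟩, ?_⟩
  apply Subtype.ext
  funext j
  ext α
  -- As `f` is close to this iterate in order, `Φ f` has at `α` the same coefficient as the next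
  -- iterate.
  have h1 : VanishesBelow m (d + 1 + α.degree) (f - (Φ^[α.degree] 0).1) := by
    intro i β hβ
    rw [Pi.sub_apply, map_sub, sub_eq_zero]
    exact hf i β _ hβ
  have hdj := hd j
  have h2 := hΦ ⟨f, hmem⟩ _ _ (by omega) h1 j α (by omega)
  rw [Pi.sub_apply, map_sub, sub_eq_zero, ← Function.iterate_succ_apply' Φ] at h2
  rw [h2]
  exact (hf j α _ (by push_cast; omega)).symm

theorem exists_forall_wnorm_le {f : MvPowerSeries (Fin n) 𝕜} (hf : IsConvergent f) {e : ℕ}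
    (he : ∀ α : Fin n →₀ ℕ, α.degree < e → MvPowerSeries.coeff α f = 0) :
    ∃ B : ℝ≥0, ∀ᶠ ρ in 𝓝[>] (0 : ℝ≥0), wnorm ρ f ≤ ((B * ρ ^ e : ℝ≥0) : ℝ≥0∞) := by
  obtain ⟨ρ₁, hρ₁, h⟩ := isConvergent_iff.1 hf
  lift wnorm ρ₁ f to ℝ≥0 using h with N hN
  refine ⟨N / ρ₁ ^ e, ?_⟩
  filter_upwards [Ioc_mem_nhdsGT (pos_iff_ne_zero.2 hρ₁)] with ρ hρ
  refine (wnorm_le_of_le_order hρ.2 hρ₁ f he).trans (le_of_eq ?_)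
  rw [← hN, ← ENNReal.coe_pow, ← ENNReal.coe_mul, div_pow]
  congr 1
  ring

/-- The increment of a `d`-regular differential analytic map around a given tuple. -/
theorem exists_wnorm_sub_le {q : ℕ} {d : ℤ} {T : Filt 𝕜 n m d → An 𝕜 n s}
    {W : (Fin n → 𝕜) × (JetIndex n m → 𝕜) → Fin s → 𝕜} (hT : IsDifferentialAnalytic W T)
    (hreg : IsJetRegular q d W) (F : Filt 𝕜 n m d) {L E : ℕ} (hL0 : 0 < L)
    (hL : (q : ℤ) + 1 - d ≤ L) (hE : (E : ℤ) = L + (q + 1 - d)) :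
    ∃ ρ₁ : ℝ≥0, ρ₁ ≠ 0 ∧ ρ₁ ≤ 1 ∧ ∃ N : ℝ≥0, ∀ (R ρ : ℝ≥0) (H : Filt 𝕜 n m d), ρ ≠ 0 → ρ ≤ ρ₁ →
      R * ρ ^ L ≤ ρ₁ → VanishesBelow m L H.1 →
      (∀ j, wnorm ρ (degMul (m j) (H.1 j)) ≤ ((R * ρ ^ (m j + L) : ℝ≥0) : ℝ≥0∞)) →
      ∀ i, wnorm ρ ((T (F + H)).1 i - (T F).1 i) ≤
        (((R * ρ₁⁻¹ ^ (L + 1) + R ^ 2 * ρ₁⁻¹ ^ 2) * ρ ^ E * N : ℝ≥0) : ℝ≥0∞) := by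
  classical
  choose c ρc hρc hc hWc using fun i => exists_expansion_along_jet F.2.1 (hT F).1 i
  obtain ⟨ρ₁, hρ₁c, hρ₁⟩ := ((eventually_all.2 fun i => eventually_wnorm_ne_top (hρc i) (hc i)).and
    (Ioc_mem_nhdsGT (zero_lt_one (α := ℝ≥0)))).exists
  have hρ₁0 : ρ₁ ≠ 0 := pos_iff_ne_zero.1 hρ₁.1
  refine ⟨ρ₁, hρ₁0, hρ₁.2, ∑ i, (wnorm ρ₁ (c i)).toNNReal, ?_⟩
  intro R ρ H hρ0 hρ hR hH hHR i
  -- Regularity gives the order `e p` of the coefficient of `∂^α H_j`, and `a p` is the exponent of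
  -- `ρ` in the bound for that derivative. In `e p + a p ≥ E` the degree `|α|` cancels.
  let e : JetIndex n m → ℕ := fun p => ((p.2.1.degree : ℤ) + q + 1 - m p.1 - d).toNat
  let a : JetIndex n m → ℕ := fun p => m p.1 + L - p.2.1.degree
  let g : JetIndex n m → MvPowerSeries (Fin n) 𝕜 := fun p => partialDeriv p.2.1 (H.1 p.1)
  have ha : ∀ p, L ≤ a p := fun p => by
    have := p.2.2
    simp only [a]
    omega
  have hρ1 : ρ ≤ 1 := hρ.trans hρ₁.2
  have hg : ∀ p, wnorm ρ (g p) ≤ ((R * ρ ^ a p : ℝ≥0) : ℝ≥0∞) := by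
    intro p
    have h1 := (wnorm_partialDeriv_mul_le ρ p.2.2 (H.1 p.1)).trans (hHR p.1)
    have h2 : m p.1 + L = a p + p.2.1.degree := by
      have := p.2.2
      simp only [a]
      omega
    rw [h2, pow_add, ← mul_assoc, ENNReal.coe_mul _ (ρ ^ p.2.1.degree), ENNReal.coe_pow] at h1
    exact (ENNReal.mul_le_mul_iff_left (pow_ne_zero _ (ENNReal.coe_ne_zero.2 hρ0))
      (ENNReal.pow_ne_top ENNReal.coe_ne_top)).1 h1
  have hgρ₁ : ∀ p, wnorm ρ (g p) ≤ ρ₁ := fun p => (hg p).trans (by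
    rw [ENNReal.coe_le_coe]
    exact (mul_le_mul' le_rfl (pow_le_pow_of_le_one zero_le hρ1 (ha p))).trans hR)
  have hjet : jet m H.1 0 = 0 := by
    ext p
    rw [jet_apply, evalAt_zero_right, ← MvPowerSeries.coeff_zero_eq_constantCoeff_apply,
      coeff_partialDeriv, zero_add, hH p.1 p.2.1 (by have := p.2.2; omega), mul_zero]
    rfl
  have h1 : (T (F + H)).1 i = comp (c i) (graphSubst g) :=
    eq_comp_graphSubst F.2.1 H.2.1 i hρ0 hρ (hρ₁c i) (hWc i) hjet hgρ₁ ((hT (F + H)).2 i)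
  have h0 : (T F).1 i = comp (c i) (graphSubst 0) := by
    have h2 := eq_comp_graphSubst (H := 0) F.2.1 (Submodule.zero_mem _) i hρ0 hρ (hρ₁c i) (hWc i)
      (jet_zero 0) (fun p => by simp [partialDeriv_zero, wnorm_zero])
      (by rw [add_zero]; exact (hT F).2 i)
    rw [h2]
    congr 2
    funext p
    exact partialDeriv_zero _
  have hlin : ∀ p (α : Fin n →₀ ℕ), α.degree < e p →
      MvPowerSeries.coeff α (linearPart p (c i)) = 0 := by
    intro p α hα
    obtain ⟨f, hf, hford⟩ := hreg F i p
    rw [linearPart_eq_of_isTaylorSeries F.2.1 (hT F).1 i (hρc i) (hc i) (hWc i) p hf]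
    exact MvPowerSeries.coeff_of_lt_order (lt_of_lt_of_le (Nat.cast_lt.2 hα) hford)
  have hmain := wnorm_comp_graphSubst_sub_le (e := e) (a := a) (L := L) (E := E) hρ0 hρ hρ₁.2 hR
    (hρ₁c i) hlin hg ha (fun p => by have := p.2.2; simp only [e]; omega) (by omega)
    (fun p => by have := p.2.2; simp only [e, a]; omega)
  rw [h1, h0]
  refine hmain.trans ?_
  rw [ENNReal.coe_mul _ (∑ i, _)]
  gcongr
  rw [← ENNReal.coe_toNNReal (hρ₁c i), ENNReal.coe_le_coe]
  exact Finset.single_le_sum (f := fun i => (wnorm ρ₁ (c i)).toNNReal) (fun _ _ => zero_le)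
    (Finset.mem_univ i)

theorem eventually_mul_le (a : ℝ≥0) {b : ℝ≥0} (hb : b ≠ 0) :
    ∀ᶠ ρ in 𝓝[>] (0 : ℝ≥0), a * ρ ≤ b := by
  have hpos : 0 < b / (a + 1) := div_pos (pos_iff_ne_zero.2 hb) (by positivity)
  filter_upwards [Ioc_mem_nhdsGT hpos] with ρ hρ
  calc a * ρ ≤ (a + 1) * (b / (a + 1)) := by
        refine mul_le_mul' le_self_add hρ.2
    _ = b := by field_simp

end

end

end BigDenominators

/-! ### The main theorem: an invariant ball for the iteration. -/

open BigDenominators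
theorem theorem3p5 {𝕜 : Type*} [RCLike 𝕜] {n r s : ℕ} (m : Fin r → ℕ) (q : ℕ) (d : ℤ)
    (hd : ∀ j, -(m j : ℤ) ≤ d)
    -- the maps `S`, `T`, `π`, the inverse of `S`, and the function `W` defining `T`
    (S : Filt 𝕜 n m d →ₗ[𝕜] An 𝕜 n s)
    (T : Filt 𝕜 n m d → An 𝕜 n s)
    (π : An 𝕜 n s →ₗ[𝕜] LinearMap.range S)
    (Sinv : LinearMap.range S →ₗ[𝕜] Filt 𝕜 n m d)
    (W : (Fin n → 𝕜) × (JetIndex n m → 𝕜) → Fin s → 𝕜)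
    (hT : IsDifferentialAnalytic W T)
    (hTord : StrictlyIncreasesOrder T ((q : ℤ) - d))
    (hT0 : ∀ i (α : Fin n →₀ ℕ), α.degree ≤ q → MvPowerSeries.coeff α ((T 0).1 i) = 0)
    (hreg : IsJetRegular q d W)
    (hSord : IncreasesOrder S ((q : ℤ) - d))
    (hπ : ∀ y : LinearMap.range S, π y = y)
    (hSinv : ∀ y : LinearMap.range S, S (Sinv y) = y)
    (hBD : ∃ C : ℝ, 0 < C ∧ ∀ G : An 𝕜 n s,
      (((q : ℤ) + 1 : ℤ) : WithTop ℤ) ≤ ord (fun _ => 0) G.1 → ∀ j : Fin r,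
        Dominates (C • HahnSeries.ofPowerSeries ℤ ℝ (hat G.1))
          (derivShift (m j) ((q : ℤ) - d) (hat fun _ : Fin 1 => (Sinv (π G)).1 j))) :
    ∃ F : Filt 𝕜 n m d, S F = π (T F) := by
  obtain ⟨C, hC, hBD⟩ := hBD
  let Φ : Filt 𝕜 n m d → Filt 𝕜 n m d := fun F => Sinv (π (T F))
  suffices h : ∃ F, Φ F = F by
    obtain ⟨F, hF⟩ := h
    refine ⟨F, ?_⟩
    conv_lhs => rw [← hF]
    exact hSinv _
  have hΦsub : ∀ F G, Φ F - Φ G = Sinv (π (T F - T G)) := fun F G => by simp [Φ]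
  have hTsub : ∀ (F G : Filt 𝕜 n m d) (L : ℤ), VanishesBelow m L (F.1 - G.1) →
      VanishesBelow (fun _ => 0) (L + (q - d) + 1) (T F - T G).1 := fun F G L h =>
    hTord.vanishesBelow_sub h
  -- This makes `hBD` applicable to every difference `T F - T G`.
  have hTsub' : ∀ F G : Filt 𝕜 n m d, VanishesBelow (fun _ => 0) (q + 1) (T F - T G).1 :=
    fun F G => (hTsub F G (d + 1) (Filt.vanishesBelow (F - G))).mono (by omega)
  have hΦ : ∀ (F G : Filt 𝕜 n m d) (L : ℤ), d + 1 ≤ L → VanishesBelow m L (F.1 - G.1) →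
      VanishesBelow m (L + 1) ((Φ F).1 - (Φ G).1) := by
    intro F G L _ h
    change VanishesBelow m (L + 1) (Φ F - Φ G).1
    rw [hΦsub]
    exact (vanishesBelow_of_dominates hC (Filt.vanishesBelow _) hd
      (hBD _ (le_ord_iff.2 (hTsub' F G))) (hTsub F G L h)).mono (by omega)
  -- Large enough for `L ≥ q + 1 - d`, so that `E ≤ 2 * L`, and for `L ≥ d + 1`, so that `K = L - (d
  -- + 1)` steps bring the order of `Φ F₀ - F₀` up to `L`.
  let L : ℕ := q + 2 + d.natAbs
  obtain ⟨E, hE⟩ := Int.eq_ofNat_of_zero_le (a := (L : ℤ) + (q + 1 - d)) (by omega)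
  obtain ⟨K, hK⟩ := Int.eq_ofNat_of_zero_le (a := (L : ℤ) - (d + 1)) (by omega)
  choose D hD using fun j => Int.eq_ofNat_of_zero_le (a := (m j : ℤ) + d) (by have := hd j; omega)
  set F₀ : Filt 𝕜 n m d := Φ^[K] 0 with hF₀
  have hF₀L : VanishesBelow m L (Φ F₀ - F₀).1 := by
    have := vanishesBelow_iterate_sub hΦ K
    rw [Function.iterate_succ_apply'] at this
    exact this.mono (by omega)
  choose B hB using fun j => exists_forall_wnorm_le (((Φ F₀ - F₀).2.1 j).degMul (m j))
    (e := m j + L) fun α hα => by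
      rw [coeff_degMul, hF₀L j α (by exact_mod_cast hα), mul_zero]
  obtain ⟨ρ₁, hρ₁0, hρ₁, N, hN⟩ := exists_wnorm_sub_le hT hreg F₀ (L := L) (E := E) (by omega)
    (by omega) hE.symm
  -- The `B j` absorb the initial error `Φ F₀ - F₀`, the `1` absorbs the increment `Φ (F₀ + H) - Φ
  -- F₀`.
  let R : ℝ≥0 := 1 + ∑ j, B j
  let A : ℝ≥0 := R * ρ₁⁻¹ ^ (L + 1) + R ^ 2 * ρ₁⁻¹ ^ 2
  let M : Fin r → ℝ≥0 := fun j => ((D j + 1) ^ m j : ℕ) * C.toNNReal * (s * (A * N))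
  obtain ⟨ρ, hρB, hρR, hρM, hρ⟩ := ((eventually_all.2 hB).and ((eventually_mul_le R hρ₁0).and
    ((eventually_all.2 fun j => eventually_mul_le (M j) one_ne_zero).and
      (Ioc_mem_nhdsGT (pos_iff_ne_zero.2 hρ₁0))))).exists
  have hρ0 : ρ ≠ 0 := pos_iff_ne_zero.1 hρ.1
  have hρ1 : ρ ≤ 1 := hρ.2.trans hρ₁
  have hRL : R * ρ ^ L ≤ ρ₁ :=
    (mul_le_mul' le_rfl (pow_le_of_le_one zero_le hρ1 (by omega))).trans hρR
  have hinv : ∀ H : Filt 𝕜 n m d, VanishesBelow m L H.1 →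
      (∀ j, wnorm ρ (degMul (m j) (H.1 j)) ≤ ((R * ρ ^ (m j + L) : ℝ≥0) : ℝ≥0∞)) →
      VanishesBelow m L (Φ (F₀ + H) - F₀).1 ∧
      ∀ j, wnorm ρ (degMul (m j) ((Φ (F₀ + H) - F₀).1 j)) ≤
        ((R * ρ ^ (m j + L) : ℝ≥0) : ℝ≥0∞) := by
    intro H hH hHR
    have hsplit : Φ (F₀ + H) - F₀ = (Φ (F₀ + H) - Φ F₀) + (Φ F₀ - F₀) := by abel
    rw [hsplit]
    constructor
    · refine VanishesBelow.add ?_ hF₀L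
      exact (hΦ (F₀ + H) F₀ L (by omega) (by simpa using hH)).mono (by omega)
    · intro j
      have h1 := pow_mul_wnorm_degMul_le hC (hD j) (hBD _ (le_ord_iff.2 (hTsub' (F₀ + H) F₀)) j)
        (fun α hα => Filt.vanishesBelow _ j α (by have := hD j; omega)) ρ
      rw [← hΦsub] at h1
      have h2 : ∑ i, wnorm ρ ((T (F₀ + H) - T F₀).1 i) ≤
          ((s * (A * ρ ^ E * N) : ℝ≥0) : ℝ≥0∞) := by
        refine (Finset.sum_le_sum fun i _ => hN R ρ H hρ0 hρ.2 hRL hH hHR i).trans (le_of_eq ?_)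
        rw [Finset.sum_const, Finset.card_univ, Fintype.card_fin, nsmul_eq_mul]
        push_cast
        rfl
      have h3 : (ρ : ℝ≥0∞) ^ q * wnorm ρ (degMul (m j) ((Φ (F₀ + H) - Φ F₀).1 j)) ≤
          (ρ : ℝ≥0∞) ^ q * ((ρ ^ (m j + L) : ℝ≥0) : ℝ≥0∞) := by
        refine h1.trans ((mul_le_mul' le_rfl h2).trans ?_)
        rw [← ENNReal.coe_pow, ← ENNReal.coe_pow, ← ENNReal.coe_natCast,
          show ENNReal.ofReal C = (C.toNNReal : ℝ≥0∞) from rfl, ← ENNReal.coe_mul,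
          ← ENNReal.coe_mul, ← ENNReal.coe_mul, ← ENNReal.coe_mul, ENNReal.coe_le_coe]
        -- The balance of exponents leaves one spare factor `ρ`, which beats the constant `M j`.
        have h4 : D j + E = q + (m j + L) + 1 := by have := hD j; omega
        calc _ = M j * ρ ^ (D j + E) := by simp only [M]; ring
          _ = ρ ^ q * ρ ^ (m j + L) * (M j * ρ) := by rw [h4]; ring
          _ ≤ ρ ^ q * ρ ^ (m j + L) * 1 := mul_le_mul' le_rfl (hρM j)
          _ = _ := mul_one _
      have h5 := (ENNReal.mul_le_mul_iff_right (pow_ne_zero q (ENNReal.coe_ne_zero.2 hρ0))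
        (ENNReal.pow_ne_top ENNReal.coe_ne_top)).1 h3
      change wnorm ρ (degMul (m j) ((Φ (F₀ + H) - Φ F₀).1 j + (Φ F₀ - F₀).1 j)) ≤ _
      rw [degMul_add]
      refine (wnorm_add_le _ _ _).trans ((add_le_add h5 (hρB j)).trans ?_)
      rw [← ENNReal.coe_add, ENNReal.coe_le_coe]
      calc ρ ^ (m j + L) + B j * ρ ^ (m j + L) = (1 + B j) * ρ ^ (m j + L) := by ring
        _ ≤ R * ρ ^ (m j + L) := by
            refine mul_le_mul' (add_le_add le_rfl ?_) le_rfl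
            exact Finset.single_le_sum (f := B) (fun _ _ => zero_le) (Finset.mem_univ j)
  have hiter : ∀ k : ℕ, VanishesBelow m L (Φ^[K + k] 0 - F₀).1 ∧
      ∀ j, wnorm ρ (degMul (m j) ((Φ^[K + k] 0 - F₀).1 j)) ≤
        ((R * ρ ^ (m j + L) : ℝ≥0) : ℝ≥0∞) := by
    intro k
    induction k with
    | zero =>
      rw [add_zero, ← hF₀, sub_self]
      refine ⟨fun j α _ => by simp, fun j => ?_⟩
      have h0 : degMul (m j) ((0 : Filt 𝕜 n m d).1 j) = 0 := by
        ext α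
        simp [coeff_degMul]
      rw [h0, wnorm_zero]
      exact zero_le
    | succ k ih =>
      have h1 := hinv _ ih.1 ih.2
      rwa [add_sub_cancel, ← Function.iterate_succ_apply' Φ] at h1
  -- The radius `ρ` was chosen for the differences from `F₀`; a smaller one makes the norm of `F₀`
  -- itself finite.
  obtain ⟨ρ', h1, h2⟩ := ((eventually_all.2 fun j => (F₀.2.1 j).eventually_wnorm_ne_top).and
    (Ioc_mem_nhdsGT hρ.1)).exists
  refine exists_fixedPoint hd hΦ (ρ := ρ') (pos_iff_ne_zero.1 h2.1)
    (R := ∑ j, (((R * ρ ^ (m j + L) : ℝ≥0) : ℝ≥0∞) + wnorm ρ' (F₀.1 j)))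
    (ENNReal.sum_ne_top.2 fun j _ => ENNReal.add_ne_top.2 ⟨ENNReal.coe_ne_top, h1 j⟩) (K := K) ?_
  intro k hk j
  obtain ⟨l, rfl⟩ := Nat.exists_eq_add_of_le hk
  refine le_trans ?_ (Finset.single_le_sum (f := fun j =>
    (((R * ρ ^ (m j + L) : ℝ≥0) : ℝ≥0∞) + wnorm ρ' (F₀.1 j))) (fun _ _ => zero_le)
    (Finset.mem_univ j))
  have h3 : (Φ^[K + l] 0).1 j = (Φ^[K + l] 0 - F₀).1 j + F₀.1 j := by simp
  rw [h3]
  refine (wnorm_add_le _ _ _).trans (add_le_add ?_ le_rfl)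
  exact (wnorm_mono h2.2 _).trans ((wnorm_le_wnorm_degMul (m j) _ _).trans ((hiter l).2 j))
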